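/- Let $E$ be a locally compact Polish space with its Borel $\sigma$-algebra, $\mathcal B_b(E)$ the bounded measurable and $\mathcal C_b(E)$ the bounded continuous real functions on $E$, $\mathcal B_\infty(E)$ the set of $f\in\mathcal B_b(E)$ such that for every $\varepsilon>0$ there is a compact $K\subset E$ with $|f|\le\varepsilon$ on $E\setminus K$, and $\mathcal C_\infty(E)=\mathcal C_b(E)\cap\mathcal B_\infty(E)$. Norms are supremum norms. A kernel operator is an operator $(Tf)(x)=\int_E f(y)\,k(x,dy)$ on $\mathcal B_b(E)$, where $k(x,\cdot)$ is a signed measure for every $x$, $x\mapsto k(x,A)$ is measurable for every Borel set $A$, and $\sup_x|k|(x,E)<\infty$; it is strong Feller if it maps $\mathcal B_b(E)$ into $\mathcal C_b(E)$. A semigroup of kernel operators is a family $T=(T(t))_{t>0}$ of kernel operators with $T(t+s)=T(t)T(s)$, of some type $(M,\omega)$, i.e. $\|T(t)\|\le Me^{\omega t}$ for all $t>0$ (with $M>0$, $\omega\in\mathbb R$), such that $(t,x)\mapsto (T(t)f)(x)$ is measurable for every $f\in\mathcal B_b(E)$. Its full generator is the set of all $(u,f)\in\mathcal B_b(E)^2$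 with $T(t)u-u=\int_0^tT(s)f\,ds$ (pointwise on $E$) for all $t>0$; its Laplace transform is $R(\lambda)f=\int_0^\infty e^{-\lambda t}T(t)f\,dt$ for $\lambda>\omega$. It is a $\mathcal C_b$-semigroup if $T(t)\mathcal C_b(E)\subset\mathcal C_b(E)$ for all $t>0$ and $\int T(t)f\,d\mu\to\int f\,d\mu$ as $t\downarrow0$ for all $f\in\mathcal C_b(E)$ and all bounded signed measures $\mu$. It is a $\mathcal C_\infty$-semigroup if $T(t)\mathcal C_\infty(E)\subset\mathcal C_\infty(E)$ for all $t>0$ and $\|T(t)f-f\|_\infty\to0$ as $t\downarrow0$ for all $f\in\mathcal C_\infty(E)$. A sequence bp-converges if it is uniformly bounded and converges pointwise; in $\mathcal B_b(E)^2$ this is meant in each component. A set $M\subset \mathcal B_b(E)^2$ is bp-closed if it contains the limits of all bp-convergent sequences in $M$; the bp-closure of $M$ is the smallest bp-closed set containing $M$. A subset $\hat D$ of $\hat A\subset\mathcal B_b(E)^2$ is a bp-core for $\hat A$ if its bp-closure is $\hat A$. **Assumptions.** Let $T$ be a $\mathcal C_b$-semigroup of type $(M,\omega)$ consisting of strong Feller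 operators, with full generator $\hat A$ and Laplace transform $R$. Put $D(\hat A)=\{u:\exists f,\ (u,f)\in\hat A\}$. Let $\hat B:D(\hat B)\to\mathcal B_b(E)$ be a linear operator defined on a linear subspace $D(\hat B)$ of $\mathcal B_b(E)$ with $D(\hat A)\subset D(\hat B)$, such that 1. for every $t>0$ the operator $\hat BT(t)$, initially defined on $D(\hat A)$, has an extension to a kernel operator on $\mathcal B_b(E)$, still denoted by $\hat BT(t)$; 2. $\hat BR(\lambda)$ is a kernel operator for one $\lambda>\omega$; 3. $(t,x)\mapsto(\hat BT(t)f)(x)$ is measurable on $(0,\infty)\times E$ for every $f\in\mathcal B_b(E)$; 4. there is a function $\varphi$, integrable on $(0,\delta)$ for some $\delta>0$, with $\|\hat BT(t)\|\le\varphi(t)$ for all $t>0$. Assume moreover that $T$ is a $\mathcal C_\infty$-semigroup and that every $T(t)$ is positive, i.e. maps nonnegative functions to nonnegative functions. Put $\hat A+\hat B=\{(u,f+\hat Bu):(u,f)\in\hat A\}$. **Theorem.** (a) If $\hat D$ is a bp-core for $\hat A$, then $\{(u,f+\hat Bu):(u,f)\in\hat D\}$ is a bp-core for $\hat A+\hat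 B$. (b) There is a $\mathcal C_b$-semigroup $S$ consisting of strong Feller operators whose full generator is $\hat A+\hat B$. If $\hat BT(t)\mathcal B_\infty(E)\subset\mathcal B_\infty(E)$ for every $t>0$, then every such semigroup $S$ is a $\mathcal C_\infty$-semigroup. -/

import Mathlib

open MeasureTheory Filter Topology Set

namespace FellerPert

noncomputable section

/-- The space of bounded (Borel) measurable real functions on `E`. -/
def Bb (E : Type*) [MeasurableSpace E] : Submodule ℝ (E → ℝ) where
  carrier := {f | Measurable f ∧ ∃ c : ℝ, ∀ x, |f x| ≤ c}
  zero_mem' := ⟨measurable_const, 0, fun x => by simp⟩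
  add_mem' := by
    rintro f g ⟨hf, c, hc⟩ ⟨hg, d, hd⟩
    exact ⟨hf.add hg, c + d, fun x => (abs_add_le _ _).trans (add_le_add (hc x) (hd x))⟩
  smul_mem' := by
    rintro a f ⟨hf, c, hc⟩
    refine ⟨hf.const_smul a, |a| * c, fun x => ?_⟩
    rw [Pi.smul_apply, smul_eq_mul, abs_mul]
    exact mul_le_mul_of_nonneg_left (hc x) (abs_nonneg a)

instance (E : Type*) [MeasurableSpace E] : CoeFun (Bb E) (fun _ => E → ℝ) := ⟨fun f => f.1⟩

/-- Integral of a function against a signed measure, via the Jordan decomposition. -/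
def sintegral {E : Type*} [MeasurableSpace E] (f : E → ℝ) (μ : SignedMeasure E) : ℝ :=
  ∫ x, f x ∂μ.toJordanDecomposition.posPart - ∫ x, f x ∂μ.toJordanDecomposition.negPart

section Operators

variable {E : Type*} [MeasurableSpace E]

/-- `L(B_b(E), σ)`: the linear operators on `B_b(E)` given by a bounded signed kernel. -/
def IsKernelOperator (T : Bb E →ₗ[ℝ] Bb E) : Prop :=
  ∃ k : E → SignedMeasure E,
    (∀ A, MeasurableSet A → Measurable fun x => k x A) ∧
    (∃ c : NNReal, ∀ x, (k x).totalVariation univ ≤ c) ∧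
    ∀ (f : Bb E) (x : E), T f x = sintegral f (k x)

/-- The operator norm of `T` for the supremum norm is at most `C`. -/
def OpNormLE (T : Bb E →ₗ[ℝ] Bb E) (C : ℝ) : Prop :=
  ∀ (f : Bb E) (c : ℝ), (∀ x, |f x| ≤ c) → ∀ x, |T f x| ≤ C * c

/-- `T` maps nonnegative functions to nonnegative functions. -/
def IsPositiveOp (T : Bb E →ₗ[ℝ] Bb E) : Prop :=
  ∀ f : Bb E, (∀ x, 0 ≤ f x) → ∀ x, 0 ≤ T f x

/-- bp-convergence of sequences in `B_b(E)`: uniformly bounded and pointwise. -/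
def BpTendsto (u : ℕ → Bb E) (v : Bb E) : Prop :=
  (∃ c : ℝ, ∀ n x, |u n x| ≤ c) ∧ ∀ x, Tendsto (fun n => u n x) atTop (𝓝 (v x))

/-- bp-closed subsets of `B_b(E) × B_b(E)`. -/
def IsBpClosed (M : Set (Bb E × Bb E)) : Prop :=
  ∀ (p : ℕ → Bb E × Bb E) (q : Bb E × Bb E), (∀ n, p n ∈ M) →
    BpTendsto (fun n => (p n).1) q.1 → BpTendsto (fun n => (p n).2) q.2 → q ∈ M

/-- The smallest bp-closed subset of `B_b(E) × B_b(E)` containing `M`. -/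
def bpClosure (M : Set (Bb E × Bb E)) : Set (Bb E × Bb E) :=
  ⋂₀ {N | IsBpClosed N ∧ M ⊆ N}

/-- `D` is a bp-core for the multivalued operator with graph `A`. -/
def IsBpCore (D A : Set (Bb E × Bb E)) : Prop :=
  D ⊆ A ∧ bpClosure D = A

/-- `T` is of type `(M, ω)`. -/
def IsOfType (T : ℝ → (Bb E →ₗ[ℝ] Bb E)) (M ω : ℝ) : Prop :=
  0 < M ∧ ∀ t, 0 < t → OpNormLE (T t) (M * Real.exp (ω * t))

/-- Semigroup of kernel operators `(T t)_{t > 0}`; the values of `T` at `t ≤ 0` play no role. -/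
structure IsKernelSemigroup (T : ℝ → (Bb E →ₗ[ℝ] Bb E)) : Prop where
  kernel : ∀ t, 0 < t → IsKernelOperator (T t)
  add : ∀ s t, 0 < s → 0 < t → ∀ f, T (t + s) f = T t (T s f)
  exp_bounded : ∃ M ω, IsOfType T M ω
  measurable : ∀ f : Bb E, Measurable fun p : Ioi (0 : ℝ) × E => T p.1 f p.2

/-- The full generator (as a graph) of a semigroup of kernel operators. -/
def fullGenerator (T : ℝ → (Bb E →ₗ[ℝ] Bb E)) : Set (Bb E × Bb E) :=
  {p | ∀ t, 0 < t → ∀ x, T t p.1 x - p.1 x = ∫ s in (0 : ℝ)..t, T s p.2 x}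

/-- The Laplace transform `R(λ) f` of the semigroup, as a function on `E`. -/
def laplaceFun (T : ℝ → (Bb E →ₗ[ℝ] Bb E)) (l : ℝ) (f : Bb E) : E → ℝ :=
  fun x => ∫ t in Ioi (0 : ℝ), Real.exp (-l * t) * T t f x

/-- `{(u, f + B u) : (u, f) ∈ A}`; for the graph `A` of a multivalued operator with
`D(A) ⊆ D(B)` this is the graph of `A + B`. -/
def addOp (A : Set (Bb E × Bb E)) (B : Bb E →ₗ.[ℝ] Bb E) : Set (Bb E × Bb E) :=
  {p | ∃ u f, (u, f) ∈ A ∧ ∃ hu : u ∈ B.domain, p = (u, f + B ⟨u, hu⟩)}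

end Operators

section Topological

variable {E : Type*} [MeasurableSpace E] [TopologicalSpace E]

/-- The space of bounded measurable functions vanishing at infinity. -/
def Binf (E : Type*) [MeasurableSpace E] [TopologicalSpace E] : Set (Bb E) :=
  {f | ∀ ε : ℝ, 0 < ε → ∃ K : Set E, IsCompact K ∧ ∀ x, x ∉ K → |f x| ≤ ε}

/-- The space of bounded continuous functions. -/
def Cb (E : Type*) [MeasurableSpace E] [TopologicalSpace E] : Set (Bb E) :=
  {f | Continuous (f : E → ℝ)}

/-- The space of continuous functions vanishing at infinity. -/
def Cinf (E : Type*) [MeasurableSpace E] [TopologicalSpace E] : Set (Bb E) :=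
  Cb E ∩ Binf E

/-- Strong Feller operators. -/
def IsStrongFeller (T : Bb E →ₗ[ℝ] Bb E) : Prop := ∀ f, T f ∈ Cb E

/-- `C_b`-semigroups: the restriction to `C_b(E)` is stochastically continuous, that is,
continuous at `0` for the weak topology induced by the bounded signed measures. -/
structure IsCbSemigroup (T : ℝ → (Bb E →ₗ[ℝ] Bb E)) : Prop extends IsKernelSemigroup T where
  map_Cb : ∀ t, 0 < t → ∀ f ∈ Cb E, T t f ∈ Cb E
  stoch_cont : ∀ f ∈ Cb E, ∀ μ : SignedMeasure E,
    Tendsto (fun t => sintegral (T t f) μ) (𝓝[>] 0) (𝓝 (sintegral f μ))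

/-- `C_∞`-semigroups: the restriction to `C_∞(E)` is strongly continuous. -/
structure IsCinfSemigroup (T : ℝ → (Bb E →ₗ[ℝ] Bb E)) : Prop extends IsKernelSemigroup T where
  map_Cinf : ∀ t, 0 < t → ∀ f ∈ Cinf E, T t f ∈ Cinf E
  strong_cont : ∀ f ∈ Cinf E,
    TendstoUniformly (fun t x => T t f x) (f : E → ℝ) (𝓝[>] 0)

/-- The standing assumptions on the semigroup `T` of type `(M, ω)` and on the perturbation `B`.
`BT t` is the extension to `B_b(E)` of the operator `B (T t)`, which is initially defined on the
domain of the full generator of `T`. -/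
structure PerturbationHyp (T : ℝ → (Bb E →ₗ[ℝ] Bb E)) (M ω : ℝ) (B : Bb E →ₗ.[ℝ] Bb E)
    (BT : ℝ → (Bb E →ₗ[ℝ] Bb E)) : Prop where
  cb : IsCbSemigroup T
  type : IsOfType T M ω
  strongFeller : ∀ t, 0 < t → IsStrongFeller (T t)
  /-- `D(A) ⊆ D(B)` -/
  domain : ∀ u f, (u, f) ∈ fullGenerator T → u ∈ B.domain
  /-- `BT t` is a kernel operator extending `B (T t)`, defined on `D(A)`. -/
  BT_kernel : ∀ t, 0 < t → IsKernelOperator (BT t)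
  BT_extends : ∀ t, 0 < t → ∀ u f, (u, f) ∈ fullGenerator T →
    ∀ h : T t u ∈ B.domain, BT t u = B ⟨T t u, h⟩
  /-- `B R(λ)` is a kernel operator for one `λ > ω`. -/
  BR_kernel : ∃ l, ω < l ∧ ∃ K : Bb E →ₗ[ℝ] Bb E, IsKernelOperator K ∧
    ∀ (f u : Bb E) (hu : u ∈ B.domain), (u : E → ℝ) = laplaceFun T l f → K f = B ⟨u, hu⟩
  BT_measurable : ∀ f : Bb E, Measurable fun p : Ioi (0 : ℝ) × E => BT p.1 f p.2
  /-- The norm of `BT t` is dominated by a function integrable near `0`. -/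
  BT_bound : ∃ φ : ℝ → ℝ, (∃ δ, 0 < δ ∧ IntegrableOn φ (Ioo 0 δ)) ∧
    ∀ t, 0 < t → OpNormLE (BT t) (φ t)

/-- `S` is the semigroup generated by `A + B`, where `A` is the full generator of `T`: a
`C_b`-semigroup of strong Feller operators whose full generator is `A + B`. -/
structure IsPerturbedSemigroup (T : ℝ → (Bb E →ₗ[ℝ] Bb E)) (B : Bb E →ₗ.[ℝ] Bb E)
    (S : ℝ → (Bb E →ₗ[ℝ] Bb E)) : Prop where
  cb : IsCbSemigroup S
  strongFeller : ∀ t, 0 < t → IsStrongFeller (S t)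
  generator : fullGenerator S = addOp (fullGenerator T) B

end Topological

end

end FellerPert

open FellerPert

namespace FellerPert

noncomputable section

/-! ### Bounded measurable functions; kernel operators as bp-continuous operators. -/

section

namespace Bb

variable {E : Type*} [MeasurableSpace E]

/-! The semigroup $S$ is the solution of the Volterra equation $S(t)=T(t)+\int_0^t
S(t-s)\,BT(s)\,ds$. A kernel operator is determined by its values on $D(\hat A)$
(`op_ext_of_generator`), which gives $BT(t+s)=BT(t)T(s)$ (`famBT_add`). Hence the integrable bound
near $0$ yields a bound $\psi$ for all times, and $q=\int e^{-\lambda s}\psi(s)\,ds<1$ for large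
$\lambda$. The Dyson–Phillips series then converges geometrically in the norm weighted by
$e^{-\lambda t}$ (`dysonSum_eq`), and uniqueness for the Volterra equation (`volterra_unique`) gives
the semigroup law.

Let $V$ be the Laplace transform of $BT$ at $\lambda$. The Volterra equation transforms into
$R_S(I-V)=R$, and $I-V$ is onto by the Neumann series. On $\hat A$ one has $\hat Bu=V(\lambda u-f)$
(`apply_eq_lap`; this is where the kernel property of $\hat BR(\lambda)$ enters), so the full
generator of $S$ is $\hat A+\hat B$ (`fullGenerator_volterra`).

For (a), the same identity shows that $(u,f)\mapsto(u,f+\hat Bu)$ is on $\hat A$ the restriction of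
a bp-continuous map, along which bp-closed sets pull back. The reverse inclusion holds because $\hat
A+\hat B$, being a full generator, is bp-closed.

For (b), the strong Feller property and invariance of $\mathcal B_\infty$ pass through the series by
dominated convergence; positivity gives the invariance for $T$ itself. Since $\|S(t)-T(t)\|\to0$,
continuity at $0$ carries over. The generator determines a strong Feller $\mathcal C_b$-semigroup,
so every admissible $S$ is the one constructed.

Throughout, kernel operators are handled as bounded operators continuous along bp-convergent
sequences (`IsBpOp`), and families are extended by $0$ to $t\le0$, so that convolutions are
integrals over $\mathbb R$. -/

theorem measurable (f : Bb E) : Measurable (f : E → ℝ) := f.2.1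

theorem exists_bound (f : Bb E) : ∃ c : ℝ, 0 ≤ c ∧ ∀ x, |f x| ≤ c := by
  obtain ⟨c, hc⟩ := f.2.2
  exact ⟨max c 0, le_max_right _ _, fun x => (hc x).trans (le_max_left _ _)⟩

theorem ext {f g : Bb E} (h : ∀ x, f x = g x) : f = g := Subtype.ext (funext h)

@[simp] theorem add_apply (f g : Bb E) (x : E) : (f + g) x = f x + g x := rfl
@[simp] theorem sub_apply (f g : Bb E) (x : E) : (f - g) x = f x - g x := rfl
@[simp] theorem neg_apply (f : Bb E) (x : E) : (-f) x = - f x := rfl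
@[simp] theorem smul_apply (a : ℝ) (f : Bb E) (x : E) : (a • f) x = a * f x := rfl
@[simp] theorem zero_apply (x : E) : (0 : Bb E) x = 0 := rfl

theorem sum_apply {ι : Type*} (s : Finset ι) (f : ι → Bb E) (x : E) :
    (∑ i ∈ s, f i : Bb E) x = ∑ i ∈ s, f i x := by
  classical
  induction s using Finset.induction_on with
  | empty => simp
  | insert a s ha ih => rw [Finset.sum_insert ha, Finset.sum_insert ha, add_apply, ih]

/-- The indicator function of a measurable set, as a bounded measurable function. -/
def ind (A : Set E) (hA : MeasurableSet A) : Bb E :=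
  ⟨A.indicator 1, measurable_one.indicator hA, 1, fun x => by
    by_cases h : x ∈ A <;> simp [h]⟩

theorem ind_apply (A : Set E) (hA : MeasurableSet A) (x : E) :
    ind A hA x = A.indicator 1 x := rfl

/-- A property of bounded measurable functions that is stable under linear combinations and
bp-limits holds everywhere once it holds for the indicators of a generating π-system. -/
theorem induction_bp {P : Bb E → Prop} (C : Set (Set E))
    (hgen : ‹MeasurableSpace E› = MeasurableSpace.generateFrom C) (hpi : IsPiSystem C)
    (hind : ∀ A (hA : MeasurableSet A), A ∈ C → P (ind A hA))
    (huniv : P (ind univ MeasurableSet.univ))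
    (hadd : ∀ f g, P f → P g → P (f + g)) (hsmul : ∀ (a : ℝ) f, P f → P (a • f))
    (hbp : ∀ u v, (∀ n, P (u n)) → BpTendsto u v → P v) (f : Bb E) : P f := by
  have hzero : P 0 := by simpa using hsmul 0 _ huniv
  have hmeas : ∀ A (hA : MeasurableSet A), P (ind A hA) := by
    intro A hA
    induction A, hA using MeasurableSpace.induction_on_inter hgen hpi with
    | empty =>
      convert hzero using 1
      exact ext fun x => by simp [ind_apply]
    | basic A hA => exact hind A _ hA
    | compl A hA ih =>
      convert hadd _ _ huniv (hsmul (-1) _ ih) using 1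
      refine ext fun x => ?_
      by_cases h : x ∈ A <;> simp [ind_apply, h]
    | iUnion A hd hA ih =>
      have hsum : ∀ n, P (∑ i ∈ Finset.range n, ind (A i) (hA i)) := by
        intro n
        induction n with
        | zero => simpa using hzero
        | succ n ihn => rw [Finset.sum_range_succ]; exact hadd _ _ ihn (ih n)
      have key : ∀ n x, (∑ i ∈ Finset.range n, ind (A i) (hA i) : Bb E) x =
          (⋃ i ∈ Finset.range n, A i).indicator 1 x := by
        intro n x
        rw [sum_apply, Finset.indicator_biUnion_apply]
        · rfl
        · intro i _ j _ hij
          exact hd hij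
      refine hbp _ _ hsum ⟨⟨1, fun n x => ?_⟩, fun x => ?_⟩
      · rw [key]
        by_cases h : x ∈ ⋃ i ∈ Finset.range n, A i <;> simp only [h, indicator_of_mem,
          indicator_of_notMem, not_false_eq_true] <;> simp
      · simp_rw [key, ind_apply]
        by_cases h : x ∈ ⋃ i, A i
        · obtain ⟨i, hi⟩ := mem_iUnion.1 h
          refine tendsto_const_nhds.congr' ?_
          filter_upwards [eventually_gt_atTop i] with n hn
          rw [indicator_of_mem h, indicator_of_mem]
          exact mem_biUnion (Finset.mem_coe.2 (Finset.mem_range.2 hn)) hi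
        · refine tendsto_const_nhds.congr fun n => ?_
          rw [indicator_of_notMem h, indicator_of_notMem]
          intro h'
          obtain ⟨i, _, hi⟩ := mem_iUnion₂.1 h'
          exact h (mem_iUnion.2 ⟨i, hi⟩)
  have hsimple : ∀ (s : SimpleFunc E ℝ) (g : Bb E), (∀ x, g x = s x) → P g := by
    intro s
    induction s using SimpleFunc.induction with
    | const c hs =>
      intro g hg
      convert hsmul c _ (hmeas _ hs) using 1
      refine ext fun x => ?_
      rw [hg, smul_apply, ind_apply]
      rename_i s
      by_cases h : x ∈ s <;> simp [h]
    | add hd ih1 ih2 =>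
      rename_i s1 s2
      intro g hg
      have hb : ∀ s : SimpleFunc E ℝ, (s : E → ℝ) ∈ Bb E := fun s =>
        ⟨s.measurable, s.exists_forall_norm_le⟩
      convert hadd ⟨s1, hb s1⟩ ⟨s2, hb s2⟩ (ih1 _ fun _ => rfl) (ih2 _ fun _ => rfl) using 1
      exact ext fun x => by rw [hg]; rfl
  obtain ⟨c, hc0, hc⟩ := Bb.exists_bound f
  have hsm := (Bb.measurable f).stronglyMeasurable
  refine hbp (fun n => ⟨hsm.approxBounded c n, (hsm.approxBounded c n).measurable,
    c, fun x => hsm.norm_approxBounded_le hc0 n x⟩) f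
    (fun n => hsimple (hsm.approxBounded c n) _ fun _ => rfl) ⟨⟨c, fun n x =>
      hsm.norm_approxBounded_le hc0 n x⟩, fun x => ?_⟩
  exact hsm.tendsto_approxBounded_of_norm_le (hc x)

end Bb

section BpOp

variable {E : Type*} [MeasurableSpace E]

theorem BpTendsto.add {u u' : ℕ → Bb E} {v v' : Bb E} (h : BpTendsto u v)
    (h' : BpTendsto u' v') : BpTendsto (fun n => u n + u' n) (v + v') := by
  obtain ⟨⟨c, hc⟩, ht⟩ := h
  obtain ⟨⟨d, hd⟩, ht'⟩ := h'
  exact ⟨⟨c + d, fun n x => (abs_add_le _ _).trans (add_le_add (hc n x) (hd n x))⟩,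
    fun x => (ht x).add (ht' x)⟩

theorem BpTendsto.const_smul {u : ℕ → Bb E} {v : Bb E} (h : BpTendsto u v) (a : ℝ) :
    BpTendsto (fun n => a • u n) (a • v) := by
  obtain ⟨⟨c, hc⟩, ht⟩ := h
  refine ⟨⟨|a| * c, fun n x => ?_⟩, fun x => (ht x).const_mul a⟩
  rw [Bb.smul_apply, abs_mul]
  exact mul_le_mul_of_nonneg_left (hc n x) (abs_nonneg a)

theorem BpTendsto.sub {u u' : ℕ → Bb E} {v v' : Bb E} (h : BpTendsto u v)
    (h' : BpTendsto u' v') : BpTendsto (fun n => u n - u' n) (v - v') := by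
  obtain ⟨⟨c, hc⟩, ht⟩ := h
  obtain ⟨⟨d, hd⟩, ht'⟩ := h'
  exact ⟨⟨c + d, fun n x => (abs_sub _ _).trans (add_le_add (hc n x) (hd n x))⟩,
    fun x => (ht x).sub (ht' x)⟩

/-- Bounded operators that are continuous along bp-convergent sequences. -/
structure IsBpOp (W : Bb E →ₗ[ℝ] Bb E) : Prop where
  bounded : ∃ C, 0 ≤ C ∧ OpNormLE W C
  tendsto : ∀ u v, BpTendsto u v → ∀ x, Tendsto (fun n => W (u n) x) atTop (𝓝 (W v x))

theorem IsBpOp.bpTendsto {W : Bb E →ₗ[ℝ] Bb E} (hW : IsBpOp W) {u : ℕ → Bb E} {v : Bb E}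
    (h : BpTendsto u v) : BpTendsto (fun n => W (u n)) (W v) := by
  obtain ⟨C, _, hC⟩ := hW.bounded
  obtain ⟨⟨c, hc⟩, _⟩ := id h
  exact ⟨⟨C * c, fun n x => hC _ _ (hc n) x⟩, hW.tendsto u v h⟩

theorem OpNormLE.mono {W : Bb E →ₗ[ℝ] Bb E} {C D : ℝ} (h : OpNormLE W C) (hCD : C ≤ D) :
    OpNormLE W D := fun f c hc x =>
  (h f c hc x).trans (mul_le_mul_of_nonneg_right hCD ((abs_nonneg _).trans (hc x)))

theorem OpNormLE.comp {W V : Bb E →ₗ[ℝ] Bb E} {C D : ℝ} (hW : OpNormLE W C) (hV : OpNormLE V D) :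
    OpNormLE (W ∘ₗ V) (C * D) := fun f c hc x => by
  rw [mul_assoc]; exact hW _ _ (hV f c hc) x

theorem opNormLE_zero {C : ℝ} (hC : 0 ≤ C) : OpNormLE (0 : Bb E →ₗ[ℝ] Bb E) C := fun f c hc x => by
  simpa using mul_nonneg hC ((abs_nonneg _).trans (hc x))

theorem isBpOp_zero : IsBpOp (0 : Bb E →ₗ[ℝ] Bb E) :=
  ⟨⟨0, le_rfl, opNormLE_zero le_rfl⟩, fun u v _ x => by simp⟩

theorem IsBpOp.comp {W V : Bb E →ₗ[ℝ] Bb E} (hW : IsBpOp W) (hV : IsBpOp V) :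
    IsBpOp (W ∘ₗ V) := by
  obtain ⟨C, hC0, hC⟩ := hW.bounded
  obtain ⟨D, hD0, hD⟩ := hV.bounded
  exact ⟨⟨C * D, mul_nonneg hC0 hD0, hC.comp hD⟩, fun u v h x =>
    hW.tendsto _ _ (hV.bpTendsto h) x⟩

theorem IsBpOp.add {W V : Bb E →ₗ[ℝ] Bb E} (hW : IsBpOp W) (hV : IsBpOp V) :
    IsBpOp (W + V) := by
  obtain ⟨C, hC0, hC⟩ := hW.bounded
  obtain ⟨D, hD0, hD⟩ := hV.bounded
  refine ⟨⟨C + D, add_nonneg hC0 hD0, fun f c hc x => ?_⟩, fun u v h x =>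
    (hW.tendsto _ _ h x).add (hV.tendsto _ _ h x)⟩
  rw [add_mul]
  exact (abs_add_le _ _).trans (add_le_add (hC f c hc x) (hD f c hc x))

theorem IsBpOp.smul {W : Bb E →ₗ[ℝ] Bb E} (hW : IsBpOp W) (a : ℝ) : IsBpOp (a • W) := by
  obtain ⟨C, hC0, hC⟩ := hW.bounded
  refine ⟨⟨|a| * C, mul_nonneg (abs_nonneg _) hC0, fun f c hc x => ?_⟩, fun u v h x =>
    (hW.tendsto _ _ h x).const_mul a⟩
  rw [LinearMap.smul_apply, Bb.smul_apply, abs_mul, mul_assoc]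
  exact mul_le_mul_of_nonneg_left (hC f c hc x) (abs_nonneg _)

theorem isBpOp_id : IsBpOp (LinearMap.id : Bb E →ₗ[ℝ] Bb E) :=
  ⟨⟨1, zero_le_one, fun f c hc x => by simpa using hc x⟩, fun _ _ h x => h.2 x⟩

theorem integrable_bb (f : Bb E) (μ : Measure E) [IsFiniteMeasure μ] :
    Integrable (f : E → ℝ) μ := by
  obtain ⟨c, _, hc⟩ := Bb.exists_bound f
  exact Integrable.of_bound (Bb.measurable f).aestronglyMeasurable c (ae_of_all _ hc)

theorem tendsto_integral_of_bpTendsto {u : ℕ → Bb E} {v : Bb E} (h : BpTendsto u v)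
    (μ : Measure E) [IsFiniteMeasure μ] :
    Tendsto (fun n => ∫ x, u n x ∂μ) atTop (𝓝 (∫ x, v x ∂μ)) := by
  obtain ⟨⟨c, hc⟩, ht⟩ := h
  exact tendsto_integral_of_dominated_convergence (fun _ => c)
    (fun n => (Bb.measurable (u n)).aestronglyMeasurable) (integrable_const c)
    (fun n => ae_of_all _ (hc n)) (ae_of_all _ ht)

theorem abs_integral_le_of_bound (f : Bb E) {c : ℝ} (hc : ∀ x, |f x| ≤ c) (μ : Measure E)
    [IsFiniteMeasure μ] : |∫ x, f x ∂μ| ≤ c * μ.real univ :=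
  (norm_integral_le_of_norm_le_const (f := fun x => f x) (ae_of_all μ hc) :)

theorem sintegral_add (f g : Bb E) (μ : SignedMeasure E) :
    sintegral (f + g : Bb E) μ = sintegral f μ + sintegral g μ := by
  simp only [sintegral, Bb.add_apply]
  rw [integral_add (integrable_bb f _) (integrable_bb g _),
    integral_add (integrable_bb f _) (integrable_bb g _)]
  ring

theorem sintegral_smul (a : ℝ) (f : Bb E) (μ : SignedMeasure E) :
    sintegral (a • f : Bb E) μ = a * sintegral f μ := by
  simp only [sintegral, Bb.smul_apply, integral_const_mul]
  ring

theorem sintegral_ind (A : Set E) (hA : MeasurableSet A) (μ : SignedMeasure E) :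
    sintegral (Bb.ind A hA) μ = μ A := by
  have h : ∀ ν : Measure E, ∫ x, Bb.ind A hA x ∂ν = ν.real A := fun ν => by
    simp only [Bb.ind_apply]
    exact integral_indicator_one hA
  rw [sintegral, h, h, μ.apply_eq_posPart_real_sub_negPart_real hA]

theorem tendsto_sintegral {u : ℕ → Bb E} {v : Bb E} (h : BpTendsto u v) (μ : SignedMeasure E) :
    Tendsto (fun n => sintegral (u n) μ) atTop (𝓝 (sintegral v μ)) :=
  (tendsto_integral_of_bpTendsto h _).sub (tendsto_integral_of_bpTendsto h _)

theorem abs_sintegral_le (f : Bb E) {c : ℝ} (hc : ∀ x, |f x| ≤ c) (μ : SignedMeasure E) :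
    |sintegral f μ| ≤ c * μ.totalVariation.real univ := by
  rw [sintegral, SignedMeasure.totalVariation, measureReal_add_apply, mul_add]
  exact (abs_sub _ _).trans (add_le_add (abs_integral_le_of_bound f hc _)
    (abs_integral_le_of_bound f hc _))

theorem IsKernelOperator.isBpOp {W : Bb E →ₗ[ℝ] Bb E} (hW : IsKernelOperator W) : IsBpOp W := by
  obtain ⟨k, -, ⟨c, hc⟩, hk⟩ := hW
  refine ⟨⟨c, c.2, fun f d hd x => ?_⟩, fun u v h x => ?_⟩
  · rw [hk, mul_comm]
    refine (abs_sintegral_le f hd _).trans (mul_le_mul_of_nonneg_left ?_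
      ((abs_nonneg _).trans (hd x)))
    exact ENNReal.toReal_le_of_le_ofReal c.2 (by simpa using hc x)
  · simp_rw [hk]
    exact tendsto_sintegral h _

/-- By bp-continuity $A\mapsto (W1_A)(x)$ is countably additive, and the integral formula extends
from indicators by `Bb.induction_bp`. This shows that operators built as integrals or series are
kernel operators, and it makes Fubini available in `IsBpOp.apply_integral`. -/
theorem IsBpOp.isKernelOperator {W : Bb E →ₗ[ℝ] Bb E} (hW : IsBpOp W) : IsKernelOperator W := by
  classical
  obtain ⟨C, hC0, hC⟩ := hW.bounded
  have hWind : ∀ A (hA : MeasurableSet A) x, |W (Bb.ind A hA) x| ≤ C := fun A hA x => by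
    have := hC (Bb.ind A hA) 1 (fun y => by by_cases h : y ∈ A <;> simp [Bb.ind_apply, h]) x
    simpa using this
  have hsum : ∀ (A : ℕ → Set E) (hA : ∀ i, MeasurableSet (A i)),
      Pairwise (Function.onFun Disjoint A) → ∀ x,
      HasSum (fun i => W (Bb.ind (A i) (hA i)) x)
        (W (Bb.ind (⋃ i, A i) (MeasurableSet.iUnion hA)) x) := by
    intro A hA hd x
    have hfin : ∀ (s : Finset ℕ) (e : ℕ → ℝ), (∀ i, |e i| ≤ 1) → ∀ y,
        |(∑ i ∈ s, e i • Bb.ind (A i) (hA i) : Bb E) y| ≤ 1 := by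
      intro s e he y
      rw [Bb.sum_apply]
      by_cases hy : ∃ j ∈ s, y ∈ A j
      · obtain ⟨j, hjs, hj⟩ := hy
        rw [Finset.sum_eq_single_of_mem j hjs]
        · simpa [Bb.ind_apply, hj] using he j
        · intro i _ hij
          have : y ∉ A i := fun hi => (Set.disjoint_left.1 (hd hij)) hi hj
          simp [Bb.ind_apply, this]
      · push Not at hy
        rw [Finset.sum_eq_zero]
        · simp
        · intro i hi
          simp [Bb.ind_apply, hy i hi]
    have hsummable : Summable fun i => W (Bb.ind (A i) (hA i)) x := by
      refine Summable.of_norm (summable_of_sum_le (c := C) (fun _ => norm_nonneg _) fun s => ?_)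
      -- The signs turn the sum into a sum of absolute values, while disjointness keeps the test
      -- function bounded by 1.
      have h1 := hC _ 1 (hfin s (fun i => SignType.sign (W (Bb.ind (A i) (hA i)) x)) (fun i => by
        rcases lt_trichotomy (W (Bb.ind (A i) (hA i)) x) 0 with h | h | h <;> simp [h])) x
      rw [map_sum, Bb.sum_apply] at h1
      have h2 := (le_abs_self _).trans h1
      simpa [map_smul, sign_mul_self] using h2
    refine (hsummable.hasSum_iff_tendsto_nat).2 ?_
    have := hW.tendsto (fun n => ∑ i ∈ Finset.range n, Bb.ind (A i) (hA i))
      (Bb.ind (⋃ i, A i) (MeasurableSet.iUnion hA)) ⟨⟨1, fun n y => by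
        simpa using hfin (Finset.range n) 1 (by simp) y⟩, fun y => ?_⟩ x
    · simpa [map_sum, Bb.sum_apply] using this
    · by_cases h : y ∈ ⋃ i, A i
      · obtain ⟨j, hj⟩ := mem_iUnion.1 h
        refine tendsto_const_nhds.congr' ?_
        filter_upwards [eventually_gt_atTop j] with n hn
        rw [Bb.sum_apply, Finset.sum_eq_single_of_mem j (Finset.mem_range.2 hn)]
        · rw [Bb.ind_apply, Bb.ind_apply, indicator_of_mem h, indicator_of_mem hj]
        · intro i _ hij
          have : y ∉ A i := fun hi => (Set.disjoint_left.1 (hd hij)) hi hj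
          simp [Bb.ind_apply, this]
      · refine tendsto_const_nhds.congr fun n => ?_
        rw [Bb.sum_apply, Finset.sum_eq_zero, Bb.ind_apply, indicator_of_notMem h]
        intro i _
        have : y ∉ A i := fun hi => h (mem_iUnion.2 ⟨i, hi⟩)
        simp [Bb.ind_apply, this]
  let k : E → SignedMeasure E := fun x =>
    { measureOf' := fun A => if hA : MeasurableSet A then W (Bb.ind A hA) x else 0
      empty' := by
        have : Bb.ind (∅ : Set E) MeasurableSet.empty = 0 := Bb.ext fun y => by
          simp [Bb.ind_apply]
        simp [this]
      not_measurable' := fun A hA => by simp [hA]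
      m_iUnion' := fun A hA hd => by
        simpa [hA, MeasurableSet.iUnion hA] using hsum A hA hd x }
  have hkA : ∀ x A (hA : MeasurableSet A), k x A = W (Bb.ind A hA) x := fun x A hA => by
    change (if hA : MeasurableSet A then W (Bb.ind A hA) x else 0) = _
    simp [hA]
  refine ⟨k, fun A hA => ?_, ⟨⟨2 * C, by positivity⟩, fun x => ?_⟩, fun f x => ?_⟩
  · simp_rw [fun x => hkA x A hA]
    exact Bb.measurable (W (Bb.ind A hA))
  -- On a Hahn decomposition each Jordan part has mass `± k x` of a measurable set, hence at most
  -- `C`; this accounts for the factor 2.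
  · obtain ⟨i, hi, h0, h0', hp, hn⟩ := (k x).toJordanDecomposition_spec
    rw [SignedMeasure.totalVariation, Measure.add_apply]
    have h1 : (k x).toJordanDecomposition.posPart univ ≤ ENNReal.ofReal C := by
      rw [ENNReal.le_ofReal_iff_toReal_le (measure_ne_top _ _) hC0, hp,
        ← Measure.real, SignedMeasure.toMeasureOfZeroLE_real_apply _ _ hi MeasurableSet.univ]
      rw [inter_univ, hkA x i hi]
      exact (le_abs_self _).trans (hWind i hi x)
    have h2 : (k x).toJordanDecomposition.negPart univ ≤ ENNReal.ofReal C := by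
      rw [ENNReal.le_ofReal_iff_toReal_le (measure_ne_top _ _) hC0, hn,
        ← Measure.real, SignedMeasure.toMeasureOfLEZero_real_apply _ _ hi.compl MeasurableSet.univ]
      rw [inter_univ, hkA x _ hi.compl]
      exact (neg_le_abs _).trans (hWind _ _ x)
    refine (add_le_add h1 h2).trans ?_
    rw [← ENNReal.ofReal_add hC0 hC0, ← two_mul, ENNReal.ofReal,
      Real.toNNReal_of_nonneg (by positivity)]
    exact le_rfl
  · refine Bb.induction_bp (P := fun f => ∀ x, W f x = sintegral f (k x)) {A | MeasurableSet A}
      MeasurableSpace.generateFrom_measurableSet.symm MeasurableSpace.isPiSystem_measurableSet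
      (fun A hA _ x => ?_) (fun x => ?_) (fun f g hf hg x => ?_) (fun a f hf x => ?_)
      (fun u v hu huv x => ?_) f x
    · rw [sintegral_ind, hkA x A hA]
    · rw [sintegral_ind, hkA x]
    · rw [map_add, Bb.add_apply, sintegral_add, hf, hg]
    · rw [map_smul, Bb.smul_apply, sintegral_smul, hf]
    · refine tendsto_nhds_unique (hW.tendsto u v huv x) ?_
      simp_rw [hu]
      exact tendsto_sintegral huv _

/-- Truncation of a measurable function at level `n`. -/
def Bb.clip (n : ℕ) {α : Type*} [MeasurableSpace α] (g : α → ℝ) (hg : Measurable g) : Bb α :=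
  ⟨fun x => max (min (g x) n) (-n), (hg.min measurable_const).max measurable_const, n, fun x =>
    abs_le.2 ⟨le_max_right _ _, max_le (min_le_right _ _) (by linarith [n.cast_nonneg (α := ℝ)])⟩⟩

theorem abs_clip_le {α : Type*} [MeasurableSpace α] (n : ℕ) {g : α → ℝ} (hg : Measurable g)
    (x : α) : |Bb.clip n g hg x| ≤ |g x| := by
  change |max (min (g x) n) (-n)| ≤ |g x|
  have := n.cast_nonneg (α := ℝ)
  rw [abs_le]
  constructor
  · rcases le_total (g x) n with h | h
    · rw [min_eq_left h]; exact (neg_abs_le _).trans (le_max_left _ _)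
    · rw [min_eq_right h]; exact (by linarith [abs_nonneg (g x)] : -|g x| ≤ n).trans (le_max_left _ _)
  · exact max_le ((min_le_left _ _).trans (le_abs_self _)) (by linarith [abs_nonneg (g x)])

theorem tendsto_clip {α : Type*} [MeasurableSpace α] {g : α → ℝ} (hg : Measurable g)
    (x : α) : Tendsto (fun n => Bb.clip n g hg x) atTop (𝓝 (g x)) := by
  obtain ⟨N, hN⟩ := exists_nat_ge |g x|
  refine tendsto_const_nhds.congr' ?_
  filter_upwards [eventually_ge_atTop N] with n hn
  have h : |g x| ≤ n := hN.trans (by exact_mod_cast hn)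
  change g x = max (min (g x) n) (-n)
  rw [min_eq_left (abs_le.1 h).2, max_eq_left (abs_le.1 h).1]

/-- The section of a bounded measurable function on a product. -/
def Bb.sect {α : Type*} [MeasurableSpace α] (F : Bb (α × E)) (a : α) : Bb E :=
  ⟨fun y => F (a, y), (Bb.measurable F).comp measurable_prodMk_left, by
    obtain ⟨c, _, hc⟩ := Bb.exists_bound F
    exact ⟨c, fun y => hc _⟩⟩

/-- For the indicator of a rectangle the section is a scalar multiple of a fixed indicator, so `hm`
applies; rectangles form a generating π-system. -/
theorem measurable_op_sect {α β : Type*} [MeasurableSpace α] [MeasurableSpace β]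
    {W : β → (Bb E →ₗ[ℝ] Bb E)} (hW : ∀ b, IsBpOp (W b))
    (hm : ∀ f, Measurable fun p : β × E => W p.1 f p.2) (F : Bb (α × E)) :
    Measurable fun p : β × α × E => W p.1 (Bb.sect F p.2.1) p.2.2 := by
  refine Bb.induction_bp
    (P := fun F => Measurable fun p : β × α × E => W p.1 (Bb.sect F p.2.1) p.2.2)
    (image2 (· ×ˢ ·) {s : Set α | MeasurableSet s} {t : Set E | MeasurableSet t})
    generateFrom_prod.symm isPiSystem_prod ?_ ?_ ?_ ?_ ?_ F
  · rintro _ hA ⟨s, hs, t, ht, rfl⟩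
    have : (fun p : β × α × E => W p.1 (Bb.sect (Bb.ind (s ×ˢ t) hA) p.2.1) p.2.2) =
        fun p => s.indicator 1 p.2.1 * W p.1 (Bb.ind t ht) p.2.2 := by
      funext p
      have h : Bb.sect (Bb.ind (s ×ˢ t) hA) p.2.1 = (s.indicator 1 p.2.1 : ℝ) • Bb.ind t ht := by
        refine Bb.ext fun y => ?_
        change (s ×ˢ t).indicator (1 : α × E → ℝ) (p.2.1, y) = s.indicator 1 p.2.1 * t.indicator 1 y
        by_cases h1 : p.2.1 ∈ s <;> by_cases h2 : y ∈ t <;> simp [h1, h2]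
      rw [h, map_smul, Bb.smul_apply]
    rw [this]
    exact ((measurable_one.indicator hs).comp (measurable_fst.comp measurable_snd)).mul
      ((hm (Bb.ind t ht)).comp (measurable_fst.prodMk (measurable_snd.comp measurable_snd)))
  · have : ∀ a : α, Bb.sect (Bb.ind univ MeasurableSet.univ : Bb (α × E)) a =
        Bb.ind univ MeasurableSet.univ := fun a => Bb.ext fun y => by
      change (univ : Set (α × E)).indicator (1 : α × E → ℝ) (a, y) = (univ : Set E).indicator 1 y
      simp
    simp_rw [this]
    exact (hm _).comp (measurable_fst.prodMk (measurable_snd.comp measurable_snd))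
  · intro F G hF hG
    have : ∀ a : α, Bb.sect (F + G) a = Bb.sect F a + Bb.sect G a := fun a => rfl
    simp_rw [this, map_add, Bb.add_apply]
    exact hF.add hG
  · intro c F hF
    have : ∀ a : α, Bb.sect (c • F) a = c • Bb.sect F a := fun a => rfl
    simp_rw [this, map_smul, Bb.smul_apply]
    exact hF.const_mul c
  · intro u v hu huv
    refine measurable_of_tendsto_metrizable hu (tendsto_pi_nhds.2 fun p => ?_)
    refine (hW p.1).tendsto _ _ ⟨?_, fun y => huv.2 _⟩ p.2.2
    obtain ⟨c, hc⟩ := huv.1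
    exact ⟨c, fun n y => hc n _⟩

/-- Each `G a` is bounded, but not uniformly in `a`; truncation reduces this to
`measurable_op_sect`. -/
theorem measurable_op_apply {α β : Type*} [MeasurableSpace α] [MeasurableSpace β]
    {W : β → (Bb E →ₗ[ℝ] Bb E)} (hW : ∀ b, IsBpOp (W b))
    (hm : ∀ f, Measurable fun p : β × E => W p.1 f p.2) {G : α → Bb E}
    (hG : Measurable fun p : α × E => G p.1 p.2) :
    Measurable fun p : β × α × E => W p.1 (G p.2.1) p.2.2 := by
  refine measurable_of_tendsto_metrizable
    (fun n => measurable_op_sect hW hm (Bb.clip n _ hG)) (tendsto_pi_nhds.2 fun p => ?_)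
  obtain ⟨c, _, hc⟩ := Bb.exists_bound (G p.2.1)
  exact (hW p.1).tendsto _ _ ⟨⟨c, fun n y => (abs_clip_le n hG _).trans (hc y)⟩,
    fun y => tendsto_clip hG _⟩ p.2.2

/-- Kernel operators commute with integrals. -/
theorem IsBpOp.apply_integral {W : Bb E →ₗ[ℝ] Bb E} (hW : IsBpOp W) {α : Type*}
    [MeasurableSpace α] {ν : Measure α} [SFinite ν] {G : α → Bb E}
    (hG : Measurable fun p : α × E => G p.1 p.2) {a : α → ℝ} (ha : Integrable a ν)
    (hGa : ∀ s y, |G s y| ≤ a s) {F : Bb E} (hF : ∀ y, F y = ∫ s, G s y ∂ν) (x : E) :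
    W F x = ∫ s, W (G s) x ∂ν := by
  obtain ⟨k, -, -, hk⟩ := hW.isKernelOperator
  -- The bound `a` does not depend on `y` and the Jordan parts are finite, so Fubini applies to each
  -- of them.
  have key : ∀ μ : Measure E, ∀ _ : IsFiniteMeasure μ,
      Integrable (fun p : α × E => G p.1 p.2) (ν.prod μ) := fun μ _ =>
    (ha.comp_fst μ).mono' hG.aestronglyMeasurable (ae_of_all _ fun p => hGa _ _)
  simp_rw [hk, sintegral, hF]
  rw [integral_sub (key _ inferInstance).integral_prod_left (key _ inferInstance).integral_prod_left,
    integral_integral_swap (f := fun s y => G s y) (key _ inferInstance),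
    integral_integral_swap (f := fun s y => G s y) (key _ inferInstance)]

end BpOp

end

/-! ### Integrals, Laplace transforms and convolutions of operator families. -/

section

variable {E : Type*} [MeasurableSpace E]

section IntOp

variable {α : Type*} [MeasurableSpace α]

/-- Measurable families of operators whose norms are dominated by the integrable function `a`. -/
structure IntegrableOps (ν : Measure α) (W : α → (Bb E →ₗ[ℝ] Bb E)) (a : α → ℝ) : Prop where
  bp : ∀ s, IsBpOp (W s)
  meas : ∀ f, Measurable fun p : α × E => W p.1 f p.2
  bound : ∀ s, OpNormLE (W s) (a s)
  int : Integrable a ν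

variable {ν : Measure α} [SFinite ν] {W : α → (Bb E →ₗ[ℝ] Bb E)} {a : α → ℝ}

omit [SFinite ν] in
theorem IntegrableOps.integrable (h : IntegrableOps ν W a) (f : Bb E) (x : E) :
    Integrable (fun s => W s f x) ν := by
  obtain ⟨c, _, hc⟩ := Bb.exists_bound f
  exact (h.int.mul_const c).mono' ((h.meas f).comp measurable_prodMk_right).aestronglyMeasurable
    (ae_of_all _ fun s => h.bound s f c hc x)

omit [SFinite ν] in
theorem IntegrableOps.abs_integral_le (h : IntegrableOps ν W a) {f : Bb E} {c : ℝ}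
    (hc : ∀ x, |f x| ≤ c) (x : E) : |∫ s, W s f x ∂ν| ≤ (∫ s, a s ∂ν) * c := by
  rw [← integral_mul_const]
  exact (norm_integral_le_of_norm_le (f := fun s => W s f x) (h.int.mul_const c)
    (ae_of_all _ fun s => h.bound s f c hc x) :)

/-- The integral of a family of operators. -/
def intOp (h : IntegrableOps ν W a) : Bb E →ₗ[ℝ] Bb E where
  toFun f := ⟨fun x => ∫ s, W s f x ∂ν,
    (h.meas f).stronglyMeasurable.integral_prod_left.measurable, by
      obtain ⟨c, _, hc⟩ := Bb.exists_bound f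
      exact ⟨_, h.abs_integral_le hc⟩⟩
  map_add' f g := Bb.ext fun x => by
    change ∫ s, W s (f + g) x ∂ν = ∫ s, W s f x ∂ν + ∫ s, W s g x ∂ν
    rw [← integral_add (h.integrable f x) (h.integrable g x)]
    simp
  map_smul' c f := Bb.ext fun x => by
    change ∫ s, W s (c • f) x ∂ν = c * ∫ s, W s f x ∂ν
    rw [← integral_const_mul]
    simp

theorem intOp_apply (h : IntegrableOps ν W a) (f : Bb E) (x : E) :
    intOp h f x = ∫ s, W s f x ∂ν := rfl

theorem opNormLE_intOp (h : IntegrableOps ν W a) : OpNormLE (intOp h) (∫ s, a s ∂ν) :=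
  fun _ _ hc x => h.abs_integral_le hc x

theorem isBpOp_intOp (h : IntegrableOps ν W a) : IsBpOp (intOp h) := by
  refine ⟨⟨_, abs_nonneg _, (opNormLE_intOp h).mono (le_abs_self _)⟩, fun u v huv x => ?_⟩
  obtain ⟨c, hc⟩ := huv.1
  simp_rw [intOp_apply]
  exact tendsto_integral_of_dominated_convergence (fun s => a s * c)
    (fun n => (h.integrable (u n) x).aestronglyMeasurable) (h.int.mul_const c)
    (fun n => ae_of_all _ fun s => h.bound s _ c (hc n) x)
    (ae_of_all _ fun s => (h.bp s).tendsto u v huv x)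

theorem IsBpOp.comp_intOp {V : Bb E →ₗ[ℝ] Bb E} (hV : IsBpOp V) (h : IntegrableOps ν W a)
    (f : Bb E) (x : E) : V (intOp h f) x = ∫ s, V (W s f) x ∂ν := by
  obtain ⟨c, _, hc⟩ := Bb.exists_bound f
  exact hV.apply_integral (h.meas f) (h.int.mul_const c) (fun s y => h.bound s f c hc y)
    (fun y => rfl) x

end IntOp

/-- A jointly measurable family of kernel operators indexed by time, vanishing at nonpositive
times. -/
structure KFam (E : Type*) [MeasurableSpace E] where
  op : ℝ → (Bb E →ₗ[ℝ] Bb E)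
  bp : ∀ t, IsBpOp (op t)
  zero : ∀ t ≤ 0, op t = 0
  meas : ∀ f, Measurable fun p : ℝ × E => op p.1 f p.2

namespace KFam

/-- Exponential bound. -/
structure ExpBd (U : KFam E) (C l : ℝ) : Prop where
  nonneg : 0 ≤ C
  bound : ∀ t, OpNormLE (U.op t) (C * Real.exp (l * t))

/-- Norm bound by a function whose Laplace transform at `l` is finite. -/
structure LapBd (U : KFam E) (ψ : ℝ → ℝ) (l : ℝ) : Prop where
  nonneg : ∀ t, 0 ≤ ψ t
  bound : ∀ t, OpNormLE (U.op t) (ψ t)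
  int : Integrable fun t => Real.exp (-l * t) * ψ t

theorem measurable_conv (U : KFam E) {G : ℝ → Bb E}
    (hG : Measurable fun p : ℝ × E => G p.1 p.2) :
    Measurable fun p : (ℝ × E) × ℝ => U.op (p.1.1 - p.2) (G p.2) p.1.2 := by
  have h := measurable_op_apply U.bp U.meas hG
  exact h.comp (f := fun p : (ℝ × E) × ℝ => (p.1.1 - p.2, p.2, p.1.2)) (by fun_prop)

theorem exp_mul_split (l t s : ℝ) :
    Real.exp (l * (t - s)) = Real.exp (l * t) * Real.exp (-l * s) := by
  rw [← Real.exp_add]; ring_nf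

/-- Since $e^{l(t-s)}=e^{lt}e^{-ls}$, finiteness of the Laplace transform of $\psi$ at $l$ is
exactly what the bound requires. The zero extensions cut the integral down to $0<s<t$. -/
theorem integrableOps_conv {U V : KFam E} {C l : ℝ} {ψ : ℝ → ℝ} (hU : U.ExpBd C l)
    (hV : V.LapBd ψ l) (t : ℝ) :
    IntegrableOps volume (fun s => U.op (t - s) ∘ₗ V.op s)
      (fun s => C * Real.exp (l * t) * (Real.exp (-l * s) * ψ s)) where
  bp s := (U.bp _).comp (V.bp _)
  meas f := (U.measurable_conv (G := fun s => V.op s f) (V.meas f)).comp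
    (f := fun p : ℝ × E => ((t, p.2), p.1)) (by fun_prop)
  bound s := by
    convert (hU.bound (t - s)).comp (hV.bound s) using 1
    rw [exp_mul_split]
    ring
  int := hV.int.const_mul _

/-- Convolution of families of operators. -/
def conv (U V : KFam E) {C l : ℝ} {ψ : ℝ → ℝ} (hU : U.ExpBd C l) (hV : V.LapBd ψ l) :
    KFam E where
  op t := intOp (integrableOps_conv hU hV t)
  bp t := isBpOp_intOp _
  zero t ht := by
    refine LinearMap.ext fun f => Bb.ext fun x => ?_
    rw [intOp_apply]
    refine (integral_congr_ae (ae_of_all _ fun s => ?_)).trans (integral_zero _ _)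
    rcases le_or_gt s 0 with h | h
    · simp [V.zero s h]
    · simp [U.zero (t - s) (by linarith)]
  meas f := (U.measurable_conv (G := fun s => V.op s f) (V.meas f)).stronglyMeasurable.integral_prod_right'.measurable

theorem expBd_conv {U V : KFam E} {C l : ℝ} {ψ : ℝ → ℝ} (hU : U.ExpBd C l) (hV : V.LapBd ψ l) :
    (conv U V hU hV).ExpBd (C * ∫ s, Real.exp (-l * s) * ψ s) l where
  nonneg := mul_nonneg hU.nonneg (integral_nonneg fun s =>
    mul_nonneg (Real.exp_pos _).le (hV.nonneg s))
  bound t := by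
    have := opNormLE_intOp (integrableOps_conv hU hV t)
    rw [integral_const_mul] at this
    refine this.mono (le_of_eq ?_)
    ring

/-- The indicator is essential: $e^{-(l'-l)t}$ is integrable only on the half-line, and the family
vanishes off it. -/
theorem ExpBd.lapBd {U : KFam E} {C l l' : ℝ} (hU : U.ExpBd C l) (hl : l < l') :
    U.LapBd ((Ioi 0).indicator fun t => C * Real.exp (l * t)) l' where
  nonneg t := indicator_nonneg (fun t _ => mul_nonneg hU.nonneg (Real.exp_pos _).le) t
  bound t := by
    rcases le_or_gt t 0 with h | h
    · rw [U.zero t h]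
      exact opNormLE_zero (indicator_nonneg (fun t _ => mul_nonneg hU.nonneg (Real.exp_pos _).le) t)
    · rw [indicator_of_mem (mem_Ioi.2 h)]
      exact hU.bound t
  int := by
    have h1 : IntegrableOn (fun t => Real.exp (-(l' - l) * t)) (Ioi 0) :=
      exp_neg_integrableOn_Ioi 0 (by linarith)
    have h2 := (integrable_indicator_iff measurableSet_Ioi).2 (h1.const_mul C)
    refine h2.congr (ae_of_all _ fun t => ?_)
    by_cases h : t ∈ Ioi (0 : ℝ)
    · simp only [indicator_of_mem h]
      rw [mul_left_comm, ← Real.exp_add]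
      ring_nf
    · simp [indicator_of_notMem h]

theorem ExpBd.mono {U : KFam E} {C l l' : ℝ} (hU : U.ExpBd C l) (hl : l ≤ l') : U.ExpBd C l' where
  nonneg := hU.nonneg
  bound t := by
    rcases le_or_gt t 0 with h | h
    · rw [U.zero t h]
      exact opNormLE_zero (mul_nonneg hU.nonneg (Real.exp_pos _).le)
    · refine (hU.bound t).mono (mul_le_mul_of_nonneg_left ?_ hU.nonneg)
      exact Real.exp_le_exp.2 (mul_le_mul_of_nonneg_right hl h.le)

theorem integrableOps_lap {U : KFam E} {ψ : ℝ → ℝ} {l : ℝ} (hU : U.LapBd ψ l) :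
    IntegrableOps volume (fun t => Real.exp (-l * t) • U.op t)
      (fun t => Real.exp (-l * t) * ψ t) where
  bp t := (U.bp t).smul _
  meas f := by
    have : Measurable fun p : ℝ × E => Real.exp (-l * p.1) := by fun_prop
    exact this.mul (U.meas f)
  bound t f c hc x := by
    rw [LinearMap.smul_apply, Bb.smul_apply, abs_mul, abs_of_pos (Real.exp_pos _), mul_assoc]
    exact mul_le_mul_of_nonneg_left (hU.bound t f c hc x) (Real.exp_pos _).le
  int := hU.int

/-- The Laplace transform of a family of operators. -/
def lap (U : KFam E) {ψ : ℝ → ℝ} {l : ℝ} (hU : U.LapBd ψ l) : Bb E →ₗ[ℝ] Bb E :=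
  intOp (integrableOps_lap hU)

theorem lap_apply {U : KFam E} {ψ : ℝ → ℝ} {l : ℝ} (hU : U.LapBd ψ l) (f : Bb E) (x : E) :
    U.lap hU f x = ∫ t, Real.exp (-l * t) * U.op t f x := rfl

theorem isBpOp_lap {U : KFam E} {ψ : ℝ → ℝ} {l : ℝ} (hU : U.LapBd ψ l) : IsBpOp (U.lap hU) :=
  isBpOp_intOp _

theorem opNormLE_lap {U : KFam E} {ψ : ℝ → ℝ} {l : ℝ} (hU : U.LapBd ψ l) :
    OpNormLE (U.lap hU) (∫ t, Real.exp (-l * t) * ψ t) := opNormLE_intOp _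

theorem op_lap_apply {W : Bb E →ₗ[ℝ] Bb E} (hW : IsBpOp W) {U : KFam E} {ψ : ℝ → ℝ} {l : ℝ}
    (hU : U.LapBd ψ l) (f : Bb E) (x : E) :
    W (U.lap hU f) x = ∫ t, Real.exp (-l * t) * W (U.op t f) x := by
  refine (hW.comp_intOp (integrableOps_lap hU) f x).trans ?_
  simp

/-- The Laplace transform turns convolution into composition. -/
theorem integral_conv {U V : KFam E} {ψU ψV : ℝ → ℝ} {l : ℝ} (hU : U.LapBd ψU l)
    (hV : V.LapBd ψV l) (f : Bb E) (x : E) :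
    ∫ t, Real.exp (-l * t) * ∫ s, U.op (t - s) (V.op s f) x = U.lap hU (V.lap hV f) x := by
  obtain ⟨c, _, hc⟩ := Bb.exists_bound f
  have hint : Integrable (fun p : ℝ × ℝ =>
      Real.exp (-l * p.1) * U.op (p.1 - p.2) (V.op p.2 f) x) (volume.prod volume) := by
    -- The dominating function is the integrand of a convolution of two integrable scalar functions.
    have h1 := (hV.int.mul_const c).convolution_integrand (ContinuousLinearMap.mul ℝ ℝ) hU.int
    refine h1.mono' ?_ (ae_of_all _ fun p => ?_)
    · have h2 := (U.measurable_conv (G := fun s => V.op s f) (V.meas f)).comp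
        (f := fun p : ℝ × ℝ => ((p.1, x), p.2)) (by fun_prop)
      have h3 : Measurable fun p : ℝ × ℝ => Real.exp (-l * p.1) := by fun_prop
      exact (h3.mul h2).aestronglyMeasurable
    · rw [Real.norm_eq_abs, abs_mul, abs_of_pos (Real.exp_pos _)]
      have h4 := hU.bound (p.1 - p.2) _ _ (hV.bound p.2 f c hc) x
      refine (mul_le_mul_of_nonneg_left h4 (Real.exp_pos _).le).trans (le_of_eq ?_)
      rw [ContinuousLinearMap.mul_apply',
        show -l * p.1 = -l * p.2 + -l * (p.1 - p.2) by ring, Real.exp_add]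
      ring
  simp_rw [← integral_const_mul]
  rw [integral_integral_swap hint, op_lap_apply (isBpOp_lap hU) hV]
  refine integral_congr_ae (ae_of_all _ fun s => ?_)
  simp only
  rw [lap_apply, ← integral_const_mul,
    ← integral_sub_right_eq_self (fun t => _ * (_ * (U.op t (V.op s f)).1 x)) s]
  refine integral_congr_ae (ae_of_all _ fun t => ?_)
  simp only
  rw [← mul_assoc, ← Real.exp_add]
  ring_nf

end KFam

/-- Uniqueness for the Volterra equation. -/
theorem volterra_unique {V : KFam E} {ψ : ℝ → ℝ} {l : ℝ} (hV : V.LapBd ψ l)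
    (hq : ∫ s, Real.exp (-l * s) * ψ s < 1) {D : ℝ → Bb E → E → ℝ} {C : ℝ}
    (hD : ∀ t f c, (∀ y, |f y| ≤ c) → ∀ x, |D t f x| ≤ C * Real.exp (l * t) * c)
    (hDV : ∀ t f x, D t f x = ∫ s, D (t - s) (V.op s f) x) (t : ℝ) (f : Bb E) (x : E) :
    D t f x = 0 := by
  set q := ∫ s, Real.exp (-l * s) * ψ s with hqdef
  have hq0 : 0 ≤ q := integral_nonneg fun s => mul_nonneg (Real.exp_pos _).le (hV.nonneg s)
  -- Each substitution of the equation into the current bound gains a factor `q`.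
  have key : ∀ n : ℕ, ∀ t f c, (∀ y, |f y| ≤ c) → ∀ x,
      |D t f x| ≤ C * Real.exp (l * t) * c * q ^ n := by
    intro n
    induction n with
    | zero => simpa using hD
    | succ n ih =>
      intro t f c hc x
      rw [hDV]
      have h1 : ∀ s, |D (t - s) (V.op s f) x| ≤
          C * Real.exp (l * t) * c * q ^ n * (Real.exp (-l * s) * ψ s) := fun s => by
        refine (ih (t - s) _ _ (hV.bound s f c hc) x).trans (le_of_eq ?_)
        rw [KFam.exp_mul_split]
        ring
      refine (norm_integral_le_of_norm_le (f := fun s => D (t - s) (V.op s f) x)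
        (hV.int.const_mul (C * Real.exp (l * t) * c * q ^ n)) (ae_of_all _ h1)).trans (le_of_eq ?_)
      rw [integral_const_mul, pow_succ, mul_assoc]
  obtain ⟨c, _, hc⟩ := Bb.exists_bound f
  have hlim : Tendsto (fun n : ℕ => C * Real.exp (l * t) * c * q ^ n) atTop (𝓝 0) := by
    simpa using (tendsto_pow_atTop_nhds_zero_of_lt_one hq0 hq).const_mul
      (C * Real.exp (l * t) * c)
  exact abs_nonpos_iff.1 (ge_of_tendsto' hlim fun n => key n t f c hc x)

/-! ### The Dyson–Phillips series. -/

section Dyson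

theorem integrable_count_pow {q : ℝ} (h0 : 0 ≤ q) (h1 : q < 1) :
    Integrable (fun n : ℕ => q ^ n) Measure.count :=
  integrable_count_iff.2 (summable_geometric_of_lt_one h0 h1).norm

theorem integral_count_nat {g : ℕ → ℝ} (hg : Summable g) :
    ∫ n, g n ∂Measure.count = ∑' n, g n := by
  rw [integral_countable (integrable_count_iff.2 hg.norm)]
  simp [Measure.real]

theorem KFam.LapBd.integral_nonneg {V : KFam E} {ψ : ℝ → ℝ} {l : ℝ} (hV : V.LapBd ψ l) :
    0 ≤ ∫ s, Real.exp (-l * s) * ψ s :=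
  MeasureTheory.integral_nonneg fun s => mul_nonneg (Real.exp_pos _).le (hV.nonneg s)

variable {T V : KFam E} {C l : ℝ} {ψ : ℝ → ℝ} (hT : T.ExpBd C l) (hV : V.LapBd ψ l)

/-- The terms of the Dyson–Phillips series, with their norm bounds. -/
def dysonAux : (n : ℕ) → {U : KFam E // U.ExpBd (C * (∫ s, Real.exp (-l * s) * ψ s) ^ n) l}
  | 0 => ⟨T, by simpa using hT⟩
  | n + 1 => ⟨KFam.conv (dysonAux n).1 V (dysonAux n).2 hV, by
      convert KFam.expBd_conv (dysonAux n).2 hV using 1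
      ring⟩

/-- The terms of the Dyson–Phillips series. -/
def dyson (n : ℕ) : KFam E := (dysonAux hT hV n).1

theorem expBd_dyson (n : ℕ) :
    (dyson hT hV n).ExpBd (C * (∫ s, Real.exp (-l * s) * ψ s) ^ n) l := (dysonAux hT hV n).2

theorem dyson_zero : dyson hT hV 0 = T := rfl

theorem dyson_succ_apply (n : ℕ) (t : ℝ) (f : Bb E) (x : E) :
    (dyson hT hV (n + 1)).op t f x = ∫ s, (dyson hT hV n).op (t - s) (V.op s f) x := rfl

variable (hq : ∫ s, Real.exp (-l * s) * ψ s < 1)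
-- The series is an integral over counting measure, so `intOp` supplies its convergence and
-- bp-continuity.
include hq in
theorem integrableOps_dyson (t : ℝ) :
    IntegrableOps Measure.count (fun n => (dyson hT hV n).op t)
      (fun n : ℕ => C * (∫ s, Real.exp (-l * s) * ψ s) ^ n * Real.exp (l * t)) where
  bp n := (dyson hT hV n).bp t
  meas f := measurable_from_prod_countable_right fun n => Bb.measurable ((dyson hT hV n).op t f)
  bound n := (expBd_dyson hT hV n).bound t
  int := ((integrable_count_pow hV.integral_nonneg hq).const_mul _).mul_const _

/-- The sum of the Dyson–Phillips series. -/
def dysonSum : KFam E where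
  op t := intOp (integrableOps_dyson hT hV hq t)
  bp t := isBpOp_intOp _
  zero t ht := by
    refine LinearMap.ext fun f => Bb.ext fun x => ?_
    rw [intOp_apply]
    refine (integral_congr_ae (ae_of_all _ fun n => ?_)).trans (integral_zero _ _)
    simp [(dyson hT hV n).zero t ht]
  meas f := by
    have : Measurable fun p : (ℝ × E) × ℕ => (dyson hT hV p.2).op p.1.1 f p.1.2 :=
      measurable_from_prod_countable_left fun n => (dyson hT hV n).meas f
    exact this.stronglyMeasurable.integral_prod_right'.measurable

theorem dysonSum_apply (t : ℝ) (f : Bb E) (x : E) :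
    (dysonSum hT hV hq).op t f x = ∫ n, (dyson hT hV n).op t f x ∂Measure.count := rfl

theorem expBd_dysonSum : (dysonSum hT hV hq).ExpBd
    (C * ∫ n, (∫ s, Real.exp (-l * s) * ψ s) ^ n ∂Measure.count) l where
  nonneg := mul_nonneg hT.nonneg (integral_nonneg fun n => pow_nonneg (integral_nonneg fun s =>
    mul_nonneg (Real.exp_pos _).le (hV.nonneg s)) n)
  bound t := by
    have := opNormLE_intOp (integrableOps_dyson hT hV hq t)
    rwa [integral_mul_const, integral_const_mul] at this

/-- The Volterra equation for the Dyson–Phillips series. -/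
theorem dysonSum_eq (t : ℝ) (f : Bb E) (x : E) :
    (dysonSum hT hV hq).op t f x =
      T.op t f x + ∫ s, (dysonSum hT hV hq).op (t - s) (V.op s f) x := by
  obtain ⟨c, _, hc⟩ := Bb.exists_bound f
  have hint : Integrable (fun p : ℝ × ℕ => (dyson hT hV p.2).op (t - p.1) (V.op p.1 f) x)
      (volume.prod Measure.count) := by
    have h1 := (hV.int.mul_prod (integrable_count_pow hV.integral_nonneg hq)).const_mul (C * Real.exp (l * t) * c)
    refine h1.mono' ?_ (ae_of_all _ fun p => ?_)
    · refine Measurable.aestronglyMeasurable (measurable_from_prod_countable_left fun n => ?_)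
      exact ((dyson hT hV n).measurable_conv (G := fun s => V.op s f) (V.meas f)).comp
        (f := fun s : ℝ => ((t, x), s)) (by fun_prop)
    · refine ((expBd_dyson hT hV p.2).bound (t - p.1) _ _ (hV.bound p.1 f c hc) x).trans
        (le_of_eq ?_)
      rw [KFam.exp_mul_split]
      ring
  simp_rw [dysonSum_apply]
  rw [integral_integral_swap hint]
  simp_rw [← dyson_succ_apply]
  have hs := (integrableOps_dyson hT hV hq t).integrable f x
  have hs' := integrable_count_iff.1 hs
  -- Index shift: convolving with `V` gives the series from `n = 1` on, and the missing zeroth term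
  -- is `T`.
  rw [integral_count_nat hs'.of_norm, integral_count_nat ((summable_nat_add_iff 1).2 hs'.of_norm),
    hs'.of_norm.tsum_eq_zero_add, dyson_zero]

end Dyson

end

/-! ### Scalar Laplace transforms; resolvents and full generators. -/

section

section Scalar

/-- Multiplying an absolutely continuous function by an exponential. -/
theorem exp_mul_sub_eq_integral {p h : ℝ → ℝ} {p0 : ℝ}
    (hint : ∀ t, IntervalIntegrable h volume 0 t)
    (hp : ∀ t, 0 < t → p t - p0 = ∫ s in (0 : ℝ)..t, h s) (c : ℝ) {t : ℝ} (ht : 0 < t) :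
    Real.exp (c * t) * p t - p0 = ∫ s in (0 : ℝ)..t, Real.exp (c * s) * (h s + c * p s) := by
  -- Primitive and exponential are absolutely continuous, so the integrated product rule holds; the
  -- primitive has derivative `h` almost everywhere.
  have hac := (hint t).absolutelyContinuousOnInterval_intervalIntegral (c := 0) (by simp)
  have hac2 : AbsolutelyContinuousOnInterval (fun _ : ℝ => p0) 0 t :=
    ContDiffOn.absolutelyContinuousOnInterval contDiffOn_const
  have hac1 := hac2.add hac
  have hace : AbsolutelyContinuousOnInterval (fun s : ℝ => Real.exp (c * s)) 0 t :=
    ContDiffOn.absolutelyContinuousOnInterval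
      (Real.contDiff_exp.comp (contDiff_const.mul contDiff_id)).contDiffOn
  have key := hace.integral_deriv_mul_eq_sub hac1
  simp only [Pi.add_apply, intervalIntegral.integral_same, add_zero, mul_zero, Real.exp_zero,
    one_mul, ← hp t ht, add_sub_cancel] at key
  rw [← key]
  apply intervalIntegral.integral_congr_ae
  filter_upwards [(hint t).ae_hasDerivAt_integral] with s hs hst
  have hst' : s ∈ uIcc 0 t := uIoc_subset_uIcc hst
  have h0s : 0 < s := by rw [uIoc_of_le ht.le] at hst; exact hst.1
  have hd := (hs hst' 0 (by simp)).const_add p0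
  have hde : HasDerivAt (fun s : ℝ => Real.exp (c * s)) (Real.exp (c * s) * c) s := by
    simpa using ((hasDerivAt_id s).const_mul c).exp
  have e1 : deriv ((fun _ : ℝ => p0) + fun x => ∫ r in (0 : ℝ)..x, h r) s = h s := hd.deriv
  rw [hde.deriv, e1, ← hp s h0s]
  ring

/-- Injectivity of the Laplace transform. -/
theorem ae_eq_zero_of_laplace {k : ℝ → ℝ} (hk : Integrable k) (hk0 : ∀ t ≤ 0, k t = 0)
    (h : ∀ n : ℕ, ∫ t, Real.exp (-n * t) * k t = 0) : ∀ᵐ t, k t = 0 := by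
  -- The hypothesis says that `k` is orthogonal to all powers of $e^{-t}$; Weierstrass approximation
  -- in $y=e^{-t}$ then reaches test functions.
  have hpoly : ∀ P : Polynomial ℝ, Integrable (fun t => P.eval (Real.exp (-t)) * k t) ∧
      ∫ t, P.eval (Real.exp (-t)) * k t = 0 := by
    intro P
    induction P using Polynomial.induction_on' with
    | add P Q hP hQ =>
      simp only [Polynomial.eval_add, add_mul]
      exact ⟨hP.1.add hQ.1, by rw [integral_add hP.1 hQ.1, hP.2, hQ.2, add_zero]⟩
    | monomial n a =>
      have e : ∀ t, (Polynomial.monomial n a).eval (Real.exp (-t)) * k t =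
          a * (Real.exp (-n * t) * k t) := fun t => by
        rw [Polynomial.eval_monomial, ← Real.exp_nat_mul]; ring_nf
      simp only [e]
      refine ⟨Integrable.const_mul (hk.norm.mono' ?_ (ae_of_all _ fun t => ?_)) a, ?_⟩
      · exact (by fun_prop : Continuous fun t : ℝ => Real.exp (-n * t)).aestronglyMeasurable.mul
          hk.aestronglyMeasurable
      · rcases le_or_gt t 0 with ht | ht
        · simp [hk0 t ht]
        · rw [norm_mul, Real.norm_eq_abs, abs_of_pos (Real.exp_pos _)]
          refine mul_le_of_le_one_left (norm_nonneg _) (Real.exp_le_one_iff.2 ?_)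
          have : 0 ≤ (n : ℝ) * t := by positivity
          linarith
      · rw [integral_const_mul, h, mul_zero]
  have hpos : ∀ᵐ t, t ∈ Ioi (0 : ℝ) → k t = 0 := by
    refine isOpen_Ioi.ae_eq_zero_of_integral_contDiff_smul_eq_zero
      (hk.locallyIntegrable.locallyIntegrableOn _) fun ψ hψ hc hsupp => ?_
    have h0 : ψ 0 = 0 := image_eq_zero_of_notMem_tsupport fun h' => lt_irrefl (0 : ℝ) (hsupp h')
    -- At `y = 0` the convention `Real.log 0 = 0` produces `ψ 0 = 0`, which is also the limit there
    -- because `ψ` has compact support.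
    have hφ : Continuous fun y : ℝ => ψ (-Real.log y) := by
      rw [continuous_iff_continuousAt]
      intro y
      by_cases hy : y = 0
      · subst hy
        rw [continuousAt_iff_punctured_nhds]
        simp only [Real.log_zero, neg_zero, h0]
        have h1 : Tendsto (fun y : ℝ => -Real.log y) (𝓝[≠] 0) atTop :=
          tendsto_neg_atBot_atTop.comp Real.tendsto_log_nhdsNE_zero
        exact (hc.is_zero_at_infty).comp (h1.mono_right atTop_le_cocompact)
      · exact (hψ.continuous.continuousAt).comp (Real.continuousAt_log hy).neg
    have hbd : ∀ ε > 0, |∫ t, ψ t • k t| ≤ ε * ∫ t, ‖k t‖ := by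
      intro ε hε
      obtain ⟨P, hP⟩ := exists_polynomial_near_of_continuousOn 0 1 _ hφ.continuousOn ε hε
      have hψint : Integrable fun t => ψ t • k t :=
        hk.bdd_mul (c := (hc.exists_bound_of_continuous hψ.continuous).choose)
          hψ.continuous.aestronglyMeasurable
          (ae_of_all _ (hc.exists_bound_of_continuous hψ.continuous).choose_spec)
      have e : ∫ t, ψ t • k t = ∫ t, (ψ t • k t - P.eval (Real.exp (-t)) * k t) := by
        rw [integral_sub hψint (hpoly P).1, (hpoly P).2, sub_zero]
      rw [e, ← integral_const_mul]
      refine norm_integral_le_of_norm_le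
        (f := fun t => ψ t • k t - P.eval (Real.exp (-t)) * k t) (hk.norm.const_mul ε)
        (ae_of_all _ fun t => ?_)
      rcases le_or_gt t 0 with ht | ht
      · simp [hk0 t ht]
      · rw [smul_eq_mul, ← sub_mul, norm_mul]
        refine mul_le_mul_of_nonneg_right ?_ (norm_nonneg _)
        have := hP (Real.exp (-t)) ⟨(Real.exp_pos _).le, Real.exp_le_one_iff.2 (by linarith)⟩
        rw [Real.log_exp, neg_neg, abs_sub_comm] at this
        exact this.le
    refine abs_nonpos_iff.1 (le_of_forall_pos_le_add fun ε hε => ?_)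
    have hn : 0 ≤ ∫ t, ‖k t‖ := integral_nonneg fun _ => norm_nonneg _
    refine (hbd (ε / (1 + ∫ t, ‖k t‖)) (by positivity)).trans ?_
    rw [zero_add, div_mul_eq_mul_div]
    exact div_le_of_le_mul₀ (by positivity) hε.le (by nlinarith)
  filter_upwards [hpos] with t ht
  rcases le_or_gt t 0 with h' | h'
  · exact hk0 t h'
  · exact ht h'

/-- A set of full measure meets every interval to the right of `t`, so almost-everywhere identities
can be passed to right limits. -/
theorem frequently_nhdsGT_of_ae {P : ℝ → Prop} (h : ∀ᵐ t : ℝ, P t) (t : ℝ) :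
    ∃ᶠ s in 𝓝[>] t, P s := by
  intro hn
  obtain ⟨b, hb, hsub⟩ := (mem_nhdsGT_iff_exists_Ioo_subset).1 hn
  have h1 : volume (Ioo t b) = 0 := measure_mono_null hsub (by simpa [compl_def] using! ae_iff.1 h)
  rw [Real.volume_Ioo, ENNReal.ofReal_eq_zero] at h1
  have := mem_Ioi.1 hb
  linarith

end Scalar

variable {E : Type*} [MeasurableSpace E]

namespace KFam

/-- The semigroup law. -/
def IsSemi (U : KFam E) : Prop :=
  ∀ s t, 0 < s → 0 < t → ∀ f, U.op (t + s) f = U.op t (U.op s f)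

/-- Extension by zero of a family defined for positive times. -/
def ofOps (W : ℝ → (Bb E →ₗ[ℝ] Bb E)) (hk : ∀ t, 0 < t → IsKernelOperator (W t))
    (hm : ∀ f : Bb E, Measurable fun p : Ioi (0 : ℝ) × E => W p.1 f p.2) : KFam E where
  op t := if 0 < t then W t else 0
  bp t := by
    split_ifs with h
    · exact (hk t h).isBpOp
    · exact isBpOp_zero
  zero t ht := if_neg ht.not_gt
  meas f := by
    refine measurable_of_restrict_of_restrict_compl (s := Ioi (0 : ℝ) ×ˢ univ)
      (measurableSet_Ioi.prod MeasurableSet.univ) ?_ ?_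
    · have h1 : Measurable fun p : ↥(Ioi (0 : ℝ) ×ˢ (univ : Set E)) =>
          ((⟨p.1.1, p.2.1⟩, p.1.2) : Ioi (0 : ℝ) × E) := by fun_prop
      convert! (hm f).comp h1 using 1
      funext p
      have : 0 < p.1.1 := p.2.1
      simp [Set.domRestrict, this]
    · convert! measurable_const (a := (0 : ℝ)) using 1
      funext p
      have : ¬ 0 < p.1.1 := fun h => p.2 ⟨h, mem_univ _⟩
      simp [Set.domRestrict, this]

theorem ofOps_op {W : ℝ → (Bb E →ₗ[ℝ] Bb E)} (hk : ∀ t, 0 < t → IsKernelOperator (W t))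
    (hm : ∀ f : Bb E, Measurable fun p : Ioi (0 : ℝ) × E => W p.1 f p.2) {t : ℝ} (ht : 0 < t) :
    (ofOps W hk hm).op t = W t := if_pos ht

variable {U : KFam E} {C w l : ℝ}

theorem measurable_op (U : KFam E) (f : Bb E) (x : E) : Measurable fun s => U.op s f x :=
  (U.meas f).comp measurable_prodMk_right

theorem ExpBd.intervalIntegrable (hU : U.ExpBd C w) (f : Bb E) (x : E) (a b : ℝ) :
    IntervalIntegrable (fun s => U.op s f x) volume a b := by
  obtain ⟨c, _, hc⟩ := Bb.exists_bound f
  have : IntervalIntegrable (fun s => C * Real.exp (w * s) * c) volume a b :=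
    Continuous.intervalIntegrable (by fun_prop) a b
  exact this.mono_fun (U.measurable_op f x).aestronglyMeasurable (ae_of_all _ fun s =>
    (hU.bound s f c hc x).trans (le_abs_self _))

theorem LapBd.integrable {ψ : ℝ → ℝ} (hU : U.LapBd ψ l) (f : Bb E) (x : E) :
    Integrable fun t => Real.exp (-l * t) * U.op t f x :=
  (integrableOps_lap hU).integrable f x

/-- The resolvent of an exponentially bounded family. -/
def res (U : KFam E) (hU : U.ExpBd C w) (hl : w < l) : Bb E →ₗ[ℝ] Bb E := U.lap (hU.lapBd hl)

theorem res_apply (hU : U.ExpBd C w) (hl : w < l) (f : Bb E) (x : E) :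
    U.res hU hl f x = ∫ t, Real.exp (-l * t) * U.op t f x := rfl

theorem isBpOp_res (hU : U.ExpBd C w) (hl : w < l) : IsBpOp (U.res hU hl) := isBpOp_lap _

theorem res_eq_laplaceFun (hU : U.ExpBd C w) (hl : w < l) (f : Bb E) :
    (U.res hU hl f : E → ℝ) = laplaceFun U.op l f := by
  funext x
  rw [res_apply, laplaceFun, ← integral_indicator measurableSet_Ioi]
  refine integral_congr_ae (ae_of_all _ fun t => ?_)
  rcases le_or_gt t 0 with h | h
  · simp [U.zero t h, indicator_of_notMem (notMem_Ioi.2 h)]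
  · simp [indicator_of_mem (mem_Ioi.2 h)]

theorem IsSemi.comm (hs : U.IsSemi) {t : ℝ} (ht : 0 < t) (s : ℝ) (f : Bb E) :
    U.op t (U.op s f) = U.op s (U.op t f) := by
  rcases le_or_gt s 0 with h | h
  · simp [U.zero s h]
  · rw [← hs s t h ht, ← hs t s ht h, add_comm]

theorem IsSemi.op_res (hs : U.IsSemi) (hU : U.ExpBd C w) (hl : w < l) {t : ℝ} (ht : 0 < t)
    (f : Bb E) : U.op t (U.res hU hl f) = U.res hU hl (U.op t f) := by
  refine Bb.ext fun x => ?_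
  rw [res, op_lap_apply (U.bp t), lap_apply]
  simp_rw [hs.comm ht]

/-- The orbit of an element of the range of the resolvent. -/
theorem IsSemi.exp_mul_op_res (hs : U.IsSemi) (hU : U.ExpBd C w) (hl : w < l) {t : ℝ}
    (ht : 0 < t) (g : Bb E) (x : E) :
    Real.exp (-l * t) * U.op t (U.res hU hl g) x - U.res hU hl g x =
      ∫ s in (0 : ℝ)..t, -(Real.exp (-l * s) * U.op s g x) := by
  have hi := (hU.lapBd hl).integrable g x
  have h1 : Real.exp (-l * t) * U.op t (U.res hU hl g) x =
      ∫ r in Ioi t, Real.exp (-l * r) * U.op r g x := by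
    rw [res, op_lap_apply (U.bp t), ← integral_const_mul,
      ← integral_sub_right_eq_self (fun s => _ * (_ * (U.op t (U.op s g)).1 x)) t,
      ← integral_indicator measurableSet_Ioi]
    refine integral_congr_ae (ae_of_all _ fun r => ?_)
    simp only
    rcases le_or_gt r t with h | h
    · simp [U.zero (r - t) (by linarith), indicator_of_notMem (notMem_Ioi.2 h)]
    · rw [indicator_of_mem (mem_Ioi.2 h), ← hs (r - t) t (by linarith) ht, ← mul_assoc,
        ← Real.exp_add]
      ring_nf
  have h2 : U.res hU hl g x = ∫ r in Ioi 0, Real.exp (-l * r) * U.op r g x := by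
    rw [res_eq_laplaceFun]; rfl
  rw [h1, h2, intervalIntegral.integral_neg, ← intervalIntegral.integral_Ioi_sub_Ioi
    hi.integrableOn ht.le]
  ring

/-- Multiply the orbit of `u` by $e^{-lt}$: letting $t\to\infty$ in the integrated equation gives
the resolvent identity. Conversely, multiplying the weighted orbit of a resolvent by $e^{lt}$
restores the generator equation. -/
theorem IsSemi.mem_fullGenerator_iff (hs : U.IsSemi) (hU : U.ExpBd C w) (hl : w < l)
    (u f : Bb E) : (u, f) ∈ fullGenerator U.op ↔ u = U.res hU hl (l • u - f) := by
  constructor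
  · intro h
    refine Bb.ext fun x => ?_
    have h1 : ∀ t, 0 < t → Real.exp (-l * t) * U.op t u x - u x =
        - ∫ s in (0 : ℝ)..t, Real.exp (-l * s) * U.op s (l • u - f) x := by
      intro t ht
      rw [exp_mul_sub_eq_integral (fun t => hU.intervalIntegrable f x 0 t)
        (fun t ht => h t ht x) (-l) ht, ← intervalIntegral.integral_neg]
      refine intervalIntegral.integral_congr fun s _ => ?_
      simp only [map_sub, map_smul, Bb.sub_apply, Bb.smul_apply]
      ring
    have hi := (hU.lapBd hl).integrable (l • u - f) x
    have h2 := intervalIntegral_tendsto_integral_Ioi 0 hi.integrableOn tendsto_id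
    have h3 : Tendsto (fun t => Real.exp (-l * t) * U.op t u x - u x) atTop (𝓝 (0 - u x)) := by
      refine Tendsto.sub_const ?_ _
      obtain ⟨c, _, hc⟩ := Bb.exists_bound u
      have h4 : Tendsto (fun t => C * c * Real.exp (-((l - w) * t))) atTop (𝓝 (C * c * 0)) := by
        refine (Real.tendsto_exp_neg_atTop_nhds_zero.comp ?_).const_mul _
        exact tendsto_id.const_mul_atTop (by linarith)
      rw [mul_zero] at h4
      refine squeeze_zero_norm (fun t => ?_) h4
      rw [norm_mul, Real.norm_eq_abs, abs_of_pos (Real.exp_pos _)]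
      refine (mul_le_mul_of_nonneg_left (hU.bound t u c hc x) (Real.exp_pos _).le).trans
        (le_of_eq ?_)
      rw [show -((l - w) * t) = -l * t + w * t by ring, Real.exp_add]
      ring
    have h5 := tendsto_nhds_unique (h3.congr' (eventually_gt_atTop 0 |>.mono h1)) h2.neg
    rw [res_eq_laplaceFun]
    simp only [zero_sub, neg_inj] at h5
    exact h5
  · intro h t ht x
    set g := l • u - f with hg
    have h1 : ∀ t, 0 < t → Real.exp (-l * t) * U.op t u x - u x =
        ∫ s in (0 : ℝ)..t, -(Real.exp (-l * s) * U.op s g x) := fun t ht => by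
      have := hs.exp_mul_op_res hU hl ht g x
      rwa [← h] at this
    have h2 := exp_mul_sub_eq_integral (fun t =>
      ((hU.lapBd hl).integrable g x).neg.intervalIntegrable) h1 l ht
    rw [← mul_assoc, ← Real.exp_add, neg_mul, add_neg_cancel, Real.exp_zero, one_mul] at h2
    rw [h2]
    refine intervalIntegral.integral_congr fun s _ => ?_
    simp only [Pi.neg_apply, hg, map_sub, map_smul, Bb.sub_apply, Bb.smul_apply]
    rw [show ∀ a b c d : ℝ, a * (-(b * (l * c - d)) + l * (b * c)) = (a * b) * d by
      intros; ring, ← Real.exp_add]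
    simp

theorem IsSemi.res_mem (hs : U.IsSemi) (hU : U.ExpBd C w) (hl : w < l) (f : Bb E) :
    (U.res hU hl f, l • U.res hU hl f - f) ∈ fullGenerator U.op := by
  rw [hs.mem_fullGenerator_iff hU hl, sub_sub_cancel]

theorem IsSemi.op_mem (hs : U.IsSemi) (hU : U.ExpBd C w) {t : ℝ} (ht : 0 < t) {u f : Bb E}
    (h : (u, f) ∈ fullGenerator U.op) : (U.op t u, U.op t f) ∈ fullGenerator U.op := by
  have hl : w < w + 1 := by linarith
  rw [hs.mem_fullGenerator_iff hU hl] at h ⊢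
  rw [← map_smul, ← map_sub, ← hs.op_res hU hl ht, ← h]

/-- The resolvent description of the generator is an equation between bp-continuous expressions. -/
theorem IsSemi.isBpClosed (hs : U.IsSemi) (hU : U.ExpBd C w) :
    IsBpClosed (fullGenerator U.op) := by
  intro p q hp h1 h2
  have hl : w < w + 1 := by linarith
  refine (hs.mem_fullGenerator_iff hU hl q.1 q.2).2 (Bb.ext fun x => ?_)
  have h3 := (h1.const_smul (w + 1)).sub h2
  refine tendsto_nhds_unique (h1.2 x) (((isBpOp_res hU hl).tendsto _ _ h3 x).congr fun n => ?_)
  rw [← (hs.mem_fullGenerator_iff hU hl _ _).1 (hp n)]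

theorem ExpBd.mono_both {C' w' : ℝ} (hU : U.ExpBd C w) (hC : C ≤ C') (hw : w ≤ w') :
    U.ExpBd C' w' where
  nonneg := hU.nonneg.trans hC
  bound t := ((hU.mono hw).bound t).mono (mul_le_mul_of_nonneg_right hC (Real.exp_pos _).le)

end KFam

end

/-! ### Uniqueness: kernel operators and semigroups determined by the generator. -/

section

variable {E : Type*} [TopologicalSpace E] [MeasurableSpace E]

-- Specialising weak continuity to Dirac measures gives pointwise continuity at time zero.
omit [TopologicalSpace E] in
theorem sintegral_dirac (f : Bb E) (x : E) :
    sintegral f (Measure.dirac x).toSignedMeasure = f x := by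
  let j : JordanDecomposition E :=
    { posPart := Measure.dirac x
      negPart := 0
      mutuallySingular := Measure.MutuallySingular.zero_right }
  have h : (Measure.dirac x).toSignedMeasure = j.toSignedMeasure := by
    simp [JordanDecomposition.toSignedMeasure, j, Measure.toSignedMeasure_zero]
  rw [h, sintegral, JordanDecomposition.toJordanDecomposition_toSignedMeasure]
  simp only [j, integral_zero_measure, sub_zero]
  exact integral_dirac' _ x (Bb.measurable f).stronglyMeasurable

/-- Two kernel operators that agree on the bounded continuous functions are equal. -/
theorem IsBpOp.eq_of_eqOn_Cb [TopologicalSpace.PseudoMetrizableSpace E] [BorelSpace E]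
    {W₁ W₂ : Bb E →ₗ[ℝ] Bb E} (h₁ : IsBpOp W₁) (h₂ : IsBpOp W₂)
    (h : ∀ f ∈ Cb E, W₁ f = W₂ f) : W₁ = W₂ := by
  refine LinearMap.ext fun f => ?_
  have hlim : ∀ (u : ℕ → Bb E) (v : Bb E), (∀ n, W₁ (u n) = W₂ (u n)) → BpTendsto u v →
      W₁ v = W₂ v := fun u v hu huv => Bb.ext fun x =>
    tendsto_nhds_unique (h₁.tendsto u v huv x) (by simpa only [hu] using h₂.tendsto u v huv x)
  refine Bb.induction_bp (P := fun f => W₁ f = W₂ f) {s | IsClosed s} ?_ isPiSystem_isClosed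
    (fun A hA hc => ?_) (h _ ?_) (fun f g hf hg => ?_) (fun a f hf => ?_) hlim f
  · rw [‹BorelSpace E›.measurable_eq, borel_eq_generateFrom_isClosed]
  · have hcl : IsClosed A := hc
    have hcont : ∀ n, Continuous fun x => (hcl.apprSeq n x : ℝ) := fun n =>
      NNReal.continuous_coe.comp (hcl.apprSeq n).continuous
    have hle : ∀ n x, |(hcl.apprSeq n x : ℝ)| ≤ 1 := fun n x => by
      rw [abs_of_nonneg (NNReal.coe_nonneg _)]
      exact_mod_cast HasOuterApproxClosed.apprSeq_apply_le_one hcl n x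
    refine hlim (fun n => ⟨fun x => hcl.apprSeq n x, (hcont n).measurable, 1, hle n⟩) _
      (fun n => h _ (hcont n)) ⟨⟨1, hle⟩, fun x => ?_⟩
    have h1 := tendsto_pi_nhds.1 (HasOuterApproxClosed.tendsto_apprSeq hcl) x
    have h2 := (NNReal.continuous_coe.tendsto _).comp h1
    convert! h2 using 2
    by_cases hx : x ∈ A <;> simp [Bb.ind_apply, hx]
  · exact (continuous_const (y := (1 : ℝ))).congr fun x => by simp [Bb.ind_apply]
  · rw [map_add, map_add, hf, hg]
  · rw [map_smul, map_smul, hf]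

namespace KFam

variable {U : KFam E} {C w l : ℝ}

/-- Pointwise continuity at time zero on bounded continuous functions. -/
def StochCont (U : KFam E) : Prop :=
  ∀ f ∈ Cb E, ∀ x, Tendsto (fun t => U.op t f x) (𝓝[>] 0) (𝓝 (f x))

theorem StochCont.bpTendsto (h : U.StochCont) (hU : U.ExpBd C w) {r : ℕ → ℝ}
    (hr : Tendsto r atTop (𝓝[>] 0)) {f : Bb E} (hf : f ∈ Cb E) :
    BpTendsto (fun n => U.op (r n) f) f := by
  obtain ⟨c, hc0, hc⟩ := Bb.exists_bound f
  have h0 : Tendsto (fun n => C * Real.exp (w * r n) * c) atTop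
      (𝓝 (C * Real.exp (w * 0) * c)) := by
    have h1 : Continuous fun t : ℝ => C * Real.exp (w * t) * c := by fun_prop
    exact (h1.tendsto 0).comp (hr.mono_right nhdsWithin_le_nhds)
  obtain ⟨b, hb⟩ := h0.bddAbove_range
  exact ⟨⟨b, fun n x => (hU.bound (r n) f c hc x).trans (hb ⟨n, rfl⟩)⟩,
    fun x => (h f hf x).comp hr⟩

section

variable [TopologicalSpace.PseudoMetrizableSpace E] [BorelSpace E]

/-- For continuous `f` the functions `U.op r f` bp-converge to `f` as `r ↓ 0`, and continuous
functions determine a kernel operator. -/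
theorem StochCont.op_ext (h : U.StochCont) (hU : U.ExpBd C w) {W₁ W₂ : Bb E →ₗ[ℝ] Bb E}
    (h₁ : IsBpOp W₁) (h₂ : IsBpOp W₂) (hW : ∀ r, 0 < r → ∀ f, W₁ (U.op r f) = W₂ (U.op r f)) :
    W₁ = W₂ := by
  refine h₁.eq_of_eqOn_Cb h₂ fun f hf => Bb.ext fun x => ?_
  have hr : Tendsto (fun n : ℕ => 1 / ((n : ℝ) + 1)) atTop (𝓝[>] 0) :=
    tendsto_nhdsWithin_iff.2 ⟨tendsto_one_div_add_atTop_nhds_zero_nat,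
      Eventually.of_forall fun n => mem_Ioi.2 (by positivity)⟩
  have hb := h.bpTendsto hU hr hf
  refine tendsto_nhds_unique (h₁.tendsto _ _ hb x) ((h₂.tendsto _ _ hb x).congr fun n => ?_)
  rw [hW _ (by positivity)]

/-- The domain of the full generator determines kernel operators. -/
theorem StochCont.op_ext_of_generator (h : U.StochCont) (hs : U.IsSemi) (hU : U.ExpBd C w)
    {W₁ W₂ : Bb E →ₗ[ℝ] Bb E} (h₁ : IsBpOp W₁) (h₂ : IsBpOp W₂)
    (hW : ∀ u f, (u, f) ∈ fullGenerator U.op → W₁ u = W₂ u) : W₁ = W₂ := by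
  refine h₁.eq_of_eqOn_Cb h₂ fun f hf => Bb.ext fun x => ?_
  set W := W₁ + (-1 : ℝ) • W₂ with hWdef
  have hWb : IsBpOp W := h₁.add (h₂.smul _)
  have hWap : ∀ g y, W g y = W₁ g y - W₂ g y := fun g y => by
    simp [hWdef, sub_eq_add_neg]
  obtain ⟨D, hD0, hD⟩ := hWb.bounded
  obtain ⟨c, hc0, hc⟩ := Bb.exists_bound f
  have hmeas : Measurable fun t => W (U.op t f) x :=
    (measurable_op_apply (β := Unit) (W := fun _ => W) (fun _ => hWb)
      (fun g => (Bb.measurable (W g)).comp measurable_snd) (G := fun t => U.op t f)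
      (U.meas f)).comp (f := fun t : ℝ => ((), t, x)) (by fun_prop)
  -- Resolvents take values in the domain, where `W` vanishes; so the Laplace transform of $t\mapsto
  -- (WU(t)f)(x)$ is zero.
  have hz : ∀ l, w < l → ∫ t, Real.exp (-l * t) * W (U.op t f) x = 0 := fun l hl => by
    rw [← op_lap_apply hWb (hU.lapBd hl), hWap]
    exact sub_eq_zero.2 (congrArg (fun g : Bb E => g x) (hW _ _ (hs.res_mem hU hl f)))
  have hl : w < w + 1 := by linarith
  have hint : Integrable fun t => Real.exp (-(w + 1) * t) * W (U.op t f) x := by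
    refine ((hU.lapBd hl).int.mul_const (D * c)).mono' ?_ (ae_of_all _ fun t => ?_)
    · exact (Measurable.mul (by fun_prop) hmeas).aestronglyMeasurable
    · rw [norm_mul, Real.norm_eq_abs, abs_of_pos (Real.exp_pos _), mul_assoc]
      refine mul_le_mul_of_nonneg_left ?_ (Real.exp_pos _).le
      exact (hD _ _ ((hU.lapBd hl).bound t f c hc) x).trans (le_of_eq (by ring))
  have hae := ae_eq_zero_of_laplace hint (fun t ht => by simp [U.zero t ht]) fun n => by
    rw [← hz (w + 1 + n) (by linarith [n.cast_nonneg (α := ℝ)])]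
    refine integral_congr_ae (ae_of_all _ fun t => ?_)
    simp only
    rw [← mul_assoc, ← Real.exp_add]
    ring_nf
  -- Vanishing for almost every time suffices: choose good times decreasing to 0 and use continuity
  -- there.
  obtain ⟨r, hr, hr0⟩ := exists_seq_forall_of_frequently (frequently_nhdsGT_of_ae hae 0)
  have hb := hWb.tendsto _ _ (h.bpTendsto hU hr hf) x
  have hzero : W f x = 0 := tendsto_nhds_unique hb (tendsto_const_nhds.congr fun n => by
    exact ((mul_eq_zero.1 (hr0 n)).resolve_left (Real.exp_pos _).ne').symm)
  rw [hWap] at hzero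
  linarith

end

/-- A strong Feller semigroup is determined by its full generator. -/
theorem op_eq_of_fullGenerator_eq {U₁ U₂ : KFam E} {C₁ C₂ w₁ w₂ : ℝ} (hs₁ : U₁.IsSemi)
    (hs₂ : U₂.IsSemi) (hU₁ : U₁.ExpBd C₁ w₁) (hU₂ : U₂.ExpBd C₂ w₂) (h₁ : U₁.StochCont)
    (h₂ : U₂.StochCont) (hF₁ : ∀ t, 0 < t → IsStrongFeller (U₁.op t))
    (hF₂ : ∀ t, 0 < t → IsStrongFeller (U₂.op t))
    (hgen : fullGenerator U₁.op = fullGenerator U₂.op) {t : ℝ} (ht : 0 < t) :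
    U₁.op t = U₂.op t := by
  refine LinearMap.ext fun f => Bb.ext fun x => ?_
  have hres : ∀ l (hl₁ : w₁ < l) (hl₂ : w₂ < l), U₁.res hU₁ hl₁ f = U₂.res hU₂ hl₂ f := by
    intro l hl₁ hl₂
    have := hs₁.res_mem hU₁ hl₁ f
    rw [hgen, hs₂.mem_fullGenerator_iff hU₂ hl₂, sub_sub_cancel] at this
    exact this
  set l := max w₁ w₂ + 1 with hldef
  have hl₁ : w₁ < l := by linarith [le_max_left w₁ w₂]
  have hl₂ : w₂ < l := by linarith [le_max_right w₁ w₂]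
  have hint := ((hU₁.lapBd hl₁).integrable f x).sub ((hU₂.lapBd hl₂).integrable f x)
  have hae := ae_eq_zero_of_laplace hint
    (fun t ht => by simp [U₁.zero t ht, U₂.zero t ht]) fun n => by
      have hn := n.cast_nonneg (α := ℝ)
      have h1 : w₁ < l + n := by linarith
      have h2 : w₂ < l + n := by linarith
      have e := congrArg (fun g : Bb E => g x) (hres (l + n) h1 h2)
      simp only [res_apply] at e
      rw [← sub_eq_zero, ← integral_sub ((hU₁.lapBd h1).integrable f x)
        ((hU₂.lapBd h2).integrable f x)] at e
      rw [← e]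
      refine integral_congr_ae (ae_of_all _ fun t => ?_)
      simp only [Pi.sub_apply]
      rw [mul_sub, ← mul_assoc, ← mul_assoc, ← Real.exp_add]
      ring_nf
  obtain ⟨r, hr, hr0⟩ := exists_seq_forall_of_frequently (frequently_nhdsGT_of_ae hae t)
  have hr' : Tendsto (fun n => r n - t) atTop (𝓝[>] 0) := by
    rw [tendsto_nhdsWithin_iff] at hr ⊢
    refine ⟨by simpa using hr.1.sub_const t, hr.2.mono fun n hn => ?_⟩
    exact mem_Ioi.2 (sub_pos.2 hn)
  have hmem := (tendsto_nhdsWithin_iff.1 hr).2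
  -- Right continuity at `t`, even for merely measurable `f`: by the strong Feller property `U.op t
  -- f` is continuous, and $U(r_n)f=U(r_n-t)U(t)f$.
  have hlim : ∀ (U : KFam E), U.IsSemi → U.StochCont → (∀ t, 0 < t → IsStrongFeller (U.op t)) →
      Tendsto (fun n => U.op (r n) f x) atTop (𝓝 (U.op t f x)) := by
    intro U hs h hF
    refine ((h _ (hF t ht f) x).comp hr').congr' (hmem.mono fun n hn => ?_)
    simp only [Function.comp_apply]
    rw [← hs t (r n - t) ht (sub_pos.2 hn), sub_add_cancel]
  refine tendsto_nhds_unique (hlim U₁ hs₁ h₁ hF₁) ((hlim U₂ hs₂ h₂ hF₂).congr fun n => ?_)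
  have := hr0 n
  simp only [Pi.sub_apply, ← mul_sub] at this
  linarith [(mul_eq_zero.1 this).resolve_left (Real.exp_pos _).ne']

end KFam

end

/-! ### Consequences of the Volterra equation. -/

section

section Algebraic

variable {E : Type*} [MeasurableSpace E]

theorem IsBpOp.pow {K : Bb E →ₗ[ℝ] Bb E} (hK : IsBpOp K) (n : ℕ) : IsBpOp (K ^ n) := by
  induction n with
  | zero => exact isBpOp_id
  | succ n ih => rw [pow_succ]; exact ih.comp hK

theorem OpNormLE.pow {K : Bb E →ₗ[ℝ] Bb E} {q : ℝ} (hK : OpNormLE K q) (n : ℕ) :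
    OpNormLE (K ^ n) (q ^ n) := by
  induction n with
  | zero => intro f c hc x; simpa using hc x
  | succ n ih => rw [pow_succ, pow_succ]; exact ih.comp hK

/-- Neumann series. -/
theorem exists_sub_apply_eq {K : Bb E →ₗ[ℝ] Bb E} (hK : IsBpOp K) {q : ℝ} (hq0 : 0 ≤ q)
    (hq : q < 1) (hKq : OpNormLE K q) (g : Bb E) : ∃ h, h - K h = g := by
  have hW : IntegrableOps Measure.count (fun n : ℕ => K ^ n) (fun n => q ^ n) :=
    { bp := fun n => hK.pow n
      meas := fun f => measurable_from_prod_countable_right fun n => Bb.measurable ((K ^ n) f)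
      bound := fun n => hKq.pow n
      int := integrable_count_pow hq0 hq }
  refine ⟨intOp hW g, Bb.ext fun x => ?_⟩
  have hs : Summable fun n : ℕ => (K ^ n) g x :=
    (integrable_count_iff.1 (hW.integrable g x)).of_norm
  rw [Bb.sub_apply, hK.comp_intOp hW, intOp_apply, integral_count_nat hs]
  have e : ∀ n : ℕ, K ((K ^ n) g) = (K ^ (n + 1)) g := fun n => by rw [pow_succ']; rfl
  simp_rw [e]
  rw [integral_count_nat ((summable_nat_add_iff (f := fun n : ℕ => (K ^ n) g x) 1).2 hs),
    hs.tsum_eq_zero_add]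
  simp

variable {T V S : KFam E} {C D w l : ℝ} {ψ : ℝ → ℝ}

/-- Solutions of the Volterra equation inherit the semigroup law. -/
theorem KFam.IsSemi.of_volterra (hs : T.IsSemi) (hV : V.LapBd ψ l)
    (hq : ∫ s, Real.exp (-l * s) * ψ s < 1)
    (hVT : ∀ s t, 0 < s → 0 < t → ∀ f, V.op (t + s) f = V.op t (T.op s f))
    (hS : S.ExpBd D l)
    (heq : ∀ t f x, S.op t f x = T.op t f x + ∫ s, S.op (t - s) (V.op s f) x) : S.IsSemi := by
  intro s t hs0 ht0 f
  refine Bb.ext fun x => ?_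
  -- With `t` fixed, the defect of the semigroup law as a function of `s`, cut off at `s ≤ 0`,
  -- solves the homogeneous Volterra equation. The constant adds the bounds of its two terms.
  have key := volterra_unique hV hq (C := D * Real.exp (l * t) + D * Real.exp (l * t) * D)
    (D := fun s f x => if 0 < s then S.op (t + s) f x - S.op t (S.op s f) x else 0) ?_ ?_ s f x
  · simp only [if_pos hs0] at key
    linarith
  · intro s f c hc x
    have hD := hS.nonneg
    have hc0 : 0 ≤ c := (abs_nonneg _).trans (hc x)
    split_ifs with h
    · refine (abs_sub _ _).trans ((add_le_add (hS.bound (t + s) f c hc x)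
        (hS.bound t _ _ (hS.bound s f c hc) x)).trans (le_of_eq ?_))
      rw [mul_add l, Real.exp_add]
      ring
    · rw [abs_zero]
      positivity
  · intro s f x
    rcases le_or_gt s 0 with h | h
    · rw [if_neg h.not_gt]
      refine ((integral_congr_ae (ae_of_all _ fun r => ?_)).trans (integral_zero _ _)).symm
      rcases le_or_gt r 0 with hr | hr
      · simp [V.zero r hr]
      · simp [show ¬ r < s by linarith]
    · rw [if_pos h]
      have hint : Integrable fun r => S.op (t + s - r) (V.op r f) x :=
        (KFam.integrableOps_conv hS hV (t + s)).integrable f x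
      have hint2 : Integrable fun r => S.op t (S.op (s - r) (V.op r f)) x := by
        obtain ⟨c, _, hc⟩ := Bb.exists_bound f
        have hm : Measurable fun r => S.op t (S.op (s - r) (V.op r f)) x :=
          (measurable_op_apply (β := Unit) (W := fun _ => S.op t) (fun _ => S.bp t)
            (fun g => (Bb.measurable (S.op t g)).comp measurable_snd)
            (G := fun r => (S.op (s - r) ∘ₗ V.op r) f)
            ((KFam.integrableOps_conv hS hV s).meas f)).comp
            (f := fun r : ℝ => ((), r, x)) (by fun_prop)
        exact ((((KFam.integrableOps_conv hS hV s).int.mul_const c).const_mul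
          (D * Real.exp (l * t)))).mono' hm.aestronglyMeasurable (ae_of_all _ fun r =>
          hS.bound t _ _ ((KFam.integrableOps_conv hS hV s).bound r f c hc) x)
      -- Beyond `r = s` the law $V(r+s)=V(r)T(s)$ turns the tail into the Volterra integral at time
      -- `t` for `T.op s f`.
      have e1 : ∫ r in Ioi s, S.op (t + s - r) (V.op r f) x =
          S.op t (T.op s f) x - T.op t (T.op s f) x := by
        rw [heq t (T.op s f) x, add_sub_cancel_left, ← integral_indicator measurableSet_Ioi,
          ← integral_add_right_eq_self _ s]
        refine integral_congr_ae (ae_of_all _ fun r => ?_)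
        simp only
        rcases le_or_gt r 0 with hr | hr
        · rw [indicator_of_notMem (by simpa using hr), V.zero r hr]
          simp
        · rw [indicator_of_mem (by simpa using hr), hVT s r h hr]
          ring_nf
      have e2 : S.op t (S.op s f) x = S.op t (T.op s f) x +
          ∫ r, S.op t (S.op (s - r) (V.op r f)) x := by
        have : S.op s f = T.op s f + (KFam.conv S V hS hV).op s f :=
          Bb.ext fun y => heq s f y
        rw [this, map_add, Bb.add_apply]
        congr 1
        exact (S.bp t).comp_intOp (KFam.integrableOps_conv hS hV s) f x
      -- Split at `r = s`; dropping the null endpoint matches the strict inequality in the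
      -- definition of the defect.
      rw [heq (t + s) f x, hs s t h ht0, e2,
        ← intervalIntegral.integral_Iic_add_Ioi hint.integrableOn hint.integrableOn (b := s), e1,
        integral_Iic_eq_integral_Iio]
      have e3 : ∀ a b c d : ℝ, a + (b + (c - a)) - (c + d) = b - d := by intros; ring
      rw [e3, ← integral_indicator measurableSet_Iio,
        ← integral_sub (hint.indicator measurableSet_Iio) hint2]
      refine integral_congr_ae (ae_of_all _ fun r => ?_)
      simp only [sub_pos]
      by_cases hr : r < s
      · rw [indicator_of_mem (mem_Iio.2 hr), if_pos hr]
        ring_nf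
      · rw [indicator_of_notMem (notMem_Iio.2 (not_lt.1 hr)), if_neg hr,
          S.zero (s - r) (by linarith)]
        simp

/-- Solutions of the Volterra equation are close to the unperturbed family for small times. -/
theorem exists_volterra_modulus (hV : V.LapBd ψ l) (hS : S.ExpBd D l)
    (heq : ∀ t f x, S.op t f x = T.op t f x + ∫ s, S.op (t - s) (V.op s f) x) :
    ∃ η : ℝ → ℝ, Tendsto η (𝓝[>] 0) (𝓝 0) ∧ ∀ t, 0 < t → ∀ (f : Bb E) c, (∀ x, |f x| ≤ c) →
      ∀ x, |S.op t f x - T.op t f x| ≤ η t * c := by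
  -- Only `0 < s ≤ t` contributes, and the primitive of an integrable function is continuous and
  -- vanishes at 0.
  refine ⟨fun t => D * Real.exp (l * t) * ∫ s in (0 : ℝ)..t, Real.exp (-l * s) * ψ s, ?_, ?_⟩
  · have h1 : Continuous fun t : ℝ => D * Real.exp (l * t) *
        ∫ s in (0 : ℝ)..t, Real.exp (-l * s) * ψ s :=
      Continuous.mul (by fun_prop)
        (intervalIntegral.continuous_primitive (fun _ _ => hV.int.intervalIntegrable) 0)
    simpa using (h1.tendsto 0).mono_left nhdsWithin_le_nhds
  · intro t ht f c hc x
    simp only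
    rw [heq, add_sub_cancel_left, intervalIntegral.integral_of_le ht.le,
      ← integral_indicator measurableSet_Ioc, mul_assoc, ← integral_mul_const,
      ← integral_const_mul]
    refine norm_integral_le_of_norm_le (f := fun s => S.op (t - s) (V.op s f) x)
      (((hV.int.indicator measurableSet_Ioc).mul_const c).const_mul _) (ae_of_all _ fun s => ?_)
    by_cases h : s ∈ Ioc 0 t
    · rw [indicator_of_mem h]
      refine ((KFam.integrableOps_conv hS hV t).bound s f c hc x).trans (le_of_eq (by ring))
    · rw [indicator_of_notMem h, zero_mul, mul_zero]
      rw [mem_Ioc, not_and_or, not_lt, not_le] at h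
      rcases h with h | h
      · simp [V.zero s h]
      · simp [S.zero (t - s) (by linarith)]

/-- The Laplace transform of the Volterra equation. -/
theorem res_volterra (hT : T.ExpBd C w) (hS : S.ExpBd D l) {l' : ℝ}
    {ψ' : ℝ → ℝ} (hV' : V.LapBd ψ' l') (hwl : w < l') (hl : l < l')
    (heq : ∀ t f x, S.op t f x = T.op t f x + ∫ s, S.op (t - s) (V.op s f) x) (f : Bb E) :
    S.res hS hl f = T.res hT hwl f + S.res hS hl (V.lap hV' f) := by
  refine Bb.ext fun x => ?_
  rw [Bb.add_apply, KFam.res, ← KFam.integral_conv, KFam.lap_apply, KFam.res_apply,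
    ← integral_add ((hT.lapBd hwl).integrable f x)]
  · refine integral_congr_ae (ae_of_all _ fun t => ?_)
    simp only
    rw [heq t f x, mul_add]
  · have h := ((hS.lapBd hl).integrable f x).sub ((hT.lapBd hwl).integrable f x)
    refine h.congr (ae_of_all _ fun t => ?_)
    simp only [Pi.sub_apply]
    rw [heq t f x]
    ring

/-- The full generator of the perturbed semigroup. -/
theorem fullGenerator_volterra (hsT : T.IsSemi) (hsS : S.IsSemi) (hT : T.ExpBd C w)
    (hS : S.ExpBd D l) {l' : ℝ} {ψ' : ℝ → ℝ} (hV' : V.LapBd ψ' l')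
    (hwl : w < l') (hl : l < l')
    (heq : ∀ t f x, S.op t f x = T.op t f x + ∫ s, S.op (t - s) (V.op s f) x)
    (hq : ∫ s, Real.exp (-l' * s) * ψ' s < 1) {B : Bb E →ₗ.[ℝ] Bb E}
    (hdom : ∀ u f, (u, f) ∈ fullGenerator T.op → u ∈ B.domain)
    (hB : ∀ u f, (u, f) ∈ fullGenerator T.op → ∀ hu : u ∈ B.domain,
      B ⟨u, hu⟩ = V.lap hV' (l' • u - f)) :
    fullGenerator S.op = addOp (fullGenerator T.op) B := by
  have hres := res_volterra hT hS hV' hwl hl heq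
  ext ⟨u, g⟩
  constructor
  · intro h
    rw [hsS.mem_fullGenerator_iff hS hl] at h
    -- With $(I-V)k=l'u-g$, the identity $R_S(I-V)=R_T$ exhibits `u` as $R_Tk$, hence as an element
    -- of the unperturbed domain.
    obtain ⟨k, hk⟩ := exists_sub_apply_eq (KFam.isBpOp_lap hV') hV'.integral_nonneg hq
      (KFam.opNormLE_lap hV') (l' • u - g)
    have hu : u = T.res hT hwl k := by
      rw [h, ← hk, map_sub, hres k, add_sub_cancel_right]
    have hmem := hsT.res_mem hT hwl k
    rw [← hu] at hmem
    refine ⟨u, _, hmem, hdom _ _ hmem, ?_⟩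
    rw [hB _ _ hmem, sub_sub_cancel]
    refine Prod.ext rfl ?_
    change g = l' • u - k + V.lap hV' k
    rw [← sub_sub_self (l' • u) g, ← hk]
    abel
  · rintro ⟨u', f, hf, hu, he⟩
    rw [he, hsS.mem_fullGenerator_iff hS hl, hB _ _ hf, ← sub_sub, map_sub, hres,
      add_sub_cancel_right]
    exact (hsT.mem_fullGenerator_iff hT hwl _ _).1 hf

end Algebraic

/-! ### Strong Feller property and decay at infinity. -/

section Topological

variable {E : Type*} [TopologicalSpace E] [MeasurableSpace E]

theorem intOp_mem_Cb [FirstCountableTopology E] {α : Type*} [MeasurableSpace α] {ν : Measure α}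
    [SFinite ν] {W : α → (Bb E →ₗ[ℝ] Bb E)} {a : α → ℝ} (h : IntegrableOps ν W a) (f : Bb E)
    (hf : ∀ s, W s f ∈ Cb E) : intOp h f ∈ Cb E := by
  obtain ⟨c, _, hc⟩ := Bb.exists_bound f
  exact continuous_of_dominated (fun x => (h.integrable f x).aestronglyMeasurable)
    (fun x => ae_of_all _ fun s => h.bound s f c hc x) (h.int.mul_const c) (ae_of_all _ hf)

theorem KFam.op_mem_Cb {U : KFam E} (hU : ∀ t, 0 < t → IsStrongFeller (U.op t)) (t : ℝ)
    (f : Bb E) : U.op t f ∈ Cb E := by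
  rcases le_or_gt t 0 with h | h
  · rw [U.zero t h]
    exact continuous_const (y := (0 : ℝ))
  · exact hU t h f

theorem dysonSum_mem_Cb [FirstCountableTopology E] {T V : KFam E} {C l : ℝ} {ψ : ℝ → ℝ}
    (hT : T.ExpBd C l) (hV : V.LapBd ψ l) (hq : ∫ s, Real.exp (-l * s) * ψ s < 1)
    (hF : ∀ t, 0 < t → IsStrongFeller (T.op t)) (t : ℝ) (f : Bb E) :
    (dysonSum hT hV hq).op t f ∈ Cb E := by
  have h : ∀ n t f, (dyson hT hV n).op t f ∈ Cb E := by
    intro n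
    induction n with
    | zero => exact KFam.op_mem_Cb hF
    | succ n ih => exact fun t f => intOp_mem_Cb (KFam.integrableOps_conv (expBd_dyson hT hV n) hV t) f fun s => ih _ _
  exact intOp_mem_Cb (integrableOps_dyson hT hV hq t) f fun n => h n t f

/-- Convergence to zero at infinity. -/
theorem mem_Binf_iff {f : Bb E} : f ∈ Binf E ↔ Tendsto (f : E → ℝ) (cocompact E) (𝓝 0) := by
  rw [Metric.tendsto_nhds]
  constructor
  · intro h ε hε
    obtain ⟨K, hK, hf⟩ := h (ε / 2) (by positivity)
    filter_upwards [hK.compl_mem_cocompact] with x hx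
    rw [Real.dist_eq, sub_zero]
    exact (hf x hx).trans_lt (by linarith)
  · intro h ε hε
    obtain ⟨K, hK, hf⟩ := mem_cocompact.1 (h ε hε)
    refine ⟨K, hK, fun x hx => ?_⟩
    have : dist (f x) 0 < ε := hf hx
    rw [Real.dist_eq, sub_zero] at this
    exact this.le

/-- Dominated convergence along the cocompact filter, which has to be countably generated. -/
theorem intOp_mem_Binf [(cocompact E).IsCountablyGenerated] {α : Type*} [MeasurableSpace α]
    {ν : Measure α}
    [SFinite ν] {W : α → (Bb E →ₗ[ℝ] Bb E)} {a : α → ℝ} (h : IntegrableOps ν W a) (f : Bb E)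
    (hf : ∀ s, W s f ∈ Binf E) : intOp h f ∈ Binf E := by
  obtain ⟨c, _, hc⟩ := Bb.exists_bound f
  rw [mem_Binf_iff]
  have := tendsto_integral_filter_of_dominated_convergence (μ := ν) (l := cocompact E)
    (F := fun x s => W s f x) (f := fun _ => (0 : ℝ)) (fun s => a s * c)
    (Eventually.of_forall fun x => (h.integrable f x).aestronglyMeasurable)
    (Eventually.of_forall fun x => ae_of_all _ fun s => h.bound s f c hc x) (h.int.mul_const c)
    (ae_of_all _ fun s => mem_Binf_iff.1 (hf s))
  rw [integral_zero] at this
  exact this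

theorem dysonSum_mem_Binf [(cocompact E).IsCountablyGenerated] {T V : KFam E} {C l : ℝ}
    {ψ : ℝ → ℝ} (hT : T.ExpBd C l) (hV : V.LapBd ψ l) (hq : ∫ s, Real.exp (-l * s) * ψ s < 1)
    (hTB : ∀ t, ∀ f ∈ Binf E, T.op t f ∈ Binf E) (hVB : ∀ t, ∀ f ∈ Binf E, V.op t f ∈ Binf E)
    (t : ℝ) (f : Bb E) (hf : f ∈ Binf E) : (dysonSum hT hV hq).op t f ∈ Binf E := by
  have h : ∀ n t, ∀ f ∈ Binf E, (dyson hT hV n).op t f ∈ Binf E := by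
    intro n
    induction n with
    | zero => exact hTB
    | succ n ih =>
      exact fun t f hf => intOp_mem_Binf (KFam.integrableOps_conv (expBd_dyson hT hV n) hV t) f fun s =>
        ih _ _ (hVB _ _ hf)
  exact intOp_mem_Binf (integrableOps_dyson hT hV hq t) f fun n => h n t f hf

/-- A bounded positive operator leaving `C_∞` invariant leaves `B_∞` invariant. -/
theorem IsPositiveOp.mem_Binf [R1Space E] [LocallyCompactSpace E] [BorelSpace E]
    {W : Bb E →ₗ[ℝ] Bb E} (hW : IsPositiveOp W) {C : ℝ} (hC : OpNormLE W C)
    (hinf : ∀ f ∈ Cinf E, W f ∈ Cinf E) {f : Bb E} (hf : f ∈ Binf E) : W f ∈ Binf E := by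
  intro ε hε
  obtain ⟨c, hc0, hc⟩ := Bb.exists_bound f
  -- With a cutoff χ equal to 1 on `K`, $|f|\le\delta+c\chi$, so positivity gives
  -- $|Wf|\le\delta\,W1+c\,W\chi$. This δ makes the first term at most ε/2, and $W\chi$ is small off
  -- a compact set. The added ones keep denominators positive.
  have hδ0 : 0 < ε / (2 * (|C| + 1)) := by positivity
  obtain ⟨K, hK, hfK⟩ := hf _ hδ0
  set δ := ε / (2 * (|C| + 1)) with hδ
  obtain ⟨χ, hχ1, -, hχc, hχ01⟩ := exists_continuous_one_zero_of_isCompact (t := ∅) hK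
    isClosed_empty (disjoint_empty K)
  have hχabs : ∀ x, |χ x| ≤ 1 := fun x => abs_le.2 ⟨by linarith [(hχ01 x).1], (hχ01 x).2⟩
  let b : Bb E := ⟨χ, χ.continuous.measurable, 1, hχabs⟩
  let e : Bb E := ⟨fun _ => 1, measurable_const, 1, fun _ => by simp⟩
  have hb : b ∈ Cinf E :=
    ⟨χ.continuous, mem_Binf_iff.2 hχc.is_zero_at_infty⟩
  obtain ⟨K', hK', hbK'⟩ := (hinf b hb).2 (ε / (2 * (c + 1))) (by positivity)
  have hdom : ∀ x, |f x| ≤ δ + c * χ x := fun x => by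
    by_cases hx : x ∈ K
    · rw [hχ1 hx, Pi.one_apply, mul_one]
      linarith [hc x]
    · have := mul_nonneg hc0 (hχ01 x).1
      linarith [hfK x hx]
  have hWdom : ∀ x, |W f x| ≤ δ * W e x + c * W b x := fun x => by
    have h1 := hW (δ • e + c • b - f) (fun y => by
      change 0 ≤ δ * 1 + c * χ y - f y
      linarith [hdom y, le_abs_self (f y)]) x
    have h2 := hW (δ • e + c • b + f) (fun y => by
      change 0 ≤ δ * 1 + c * χ y + f y
      linarith [hdom y, neg_abs_le (f y)]) x
    simp only [map_add, map_sub, map_smul, Bb.add_apply, Bb.sub_apply, Bb.smul_apply] at h1 h2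
    rw [abs_le]
    constructor <;> linarith
  refine ⟨K', hK', fun x hx => (hWdom x).trans ?_⟩
  have h1 : δ * W e x ≤ ε / 2 := by
    have h2 : W e x ≤ |C| + 1 := by
      have := hC e 1 (fun _ => by simp [e]) x
      linarith [le_abs_self (W e x), le_abs_self C]
    calc δ * W e x ≤ δ * (|C| + 1) := mul_le_mul_of_nonneg_left h2 hδ0.le
      _ = ε / 2 := by rw [hδ]; field_simp
  have h3 : c * W b x ≤ ε / 2 := by
    calc c * W b x ≤ (c + 1) * (ε / (2 * (c + 1))) :=
          mul_le_mul (by linarith) ((le_abs_self _).trans (hbK' x hx))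
            (hW b (fun y => (hχ01 y).1) x) (by linarith)
      _ = ε / 2 := by field_simp
  linarith

end Topological

end

/-! ### The perturbation hypotheses: bounds, the semigroup and bp-cores. -/

section

theorem isCountablyGenerated_cocompact (E : Type*) [TopologicalSpace E] [SigmaCompactSpace E]
    [WeaklyLocallyCompactSpace E] : (cocompact E).IsCountablyGenerated := by
  let K : CompactExhaustion E := default
  have hb : (cocompact E).HasBasis (fun _ : ℕ => True) (fun n => (K n)ᶜ) := by
    refine ⟨fun s => ⟨fun hs => ?_, ?_⟩⟩
    · obtain ⟨t, ht, hts⟩ := mem_cocompact.1 hs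
      obtain ⟨n, hn⟩ := K.exists_superset_of_isCompact ht
      exact ⟨n, trivial, (compl_subset_compl.2 hn).trans hts⟩
    · rintro ⟨n, -, hn⟩
      exact mem_of_superset (K.isCompact n).compl_mem_cocompact hn
  exact hb.isCountablyGenerated

section Algebraic

variable {E : Type*} [MeasurableSpace E]

theorem fullGenerator_congr {T T' : ℝ → (Bb E →ₗ[ℝ] Bb E)} (h : ∀ t, 0 < t → T t = T' t) :
    fullGenerator T = fullGenerator T' := by
  ext p
  refine forall_congr' fun t => forall_congr' fun ht => forall_congr' fun x => ?_
  have : ∫ s in (0 : ℝ)..t, T s p.2 x = ∫ s in (0 : ℝ)..t, T' s p.2 x := by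
    refine intervalIntegral.integral_congr_ae (ae_of_all _ fun s hs => ?_)
    rw [uIoc_of_le ht.le] at hs
    rw [h s hs.1]
  rw [h t ht, this]

variable {T : ℝ → (Bb E →ₗ[ℝ] Bb E)} {M w : ℝ}

/-- A semigroup of kernel operators, extended by zero. -/
def IsKernelSemigroup.fam (h : IsKernelSemigroup T) : KFam E :=
  KFam.ofOps T h.kernel h.measurable

theorem IsKernelSemigroup.fam_op (h : IsKernelSemigroup T) {t : ℝ} (ht : 0 < t) :
    h.fam.op t = T t := KFam.ofOps_op _ _ ht

theorem IsKernelSemigroup.isSemi (h : IsKernelSemigroup T) : h.fam.IsSemi := fun s t hs ht f => by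
  rw [h.fam_op hs, h.fam_op ht, h.fam_op (add_pos ht hs), h.add s t hs ht]

theorem IsKernelSemigroup.expBd (h : IsKernelSemigroup T) (hM : IsOfType T M w) :
    h.fam.ExpBd M w where
  nonneg := hM.1.le
  bound t := by
    rcases le_or_gt t 0 with ht | ht
    · rw [h.fam.zero t ht]
      exact opNormLE_zero (mul_nonneg hM.1.le (Real.exp_pos _).le)
    · rw [h.fam_op ht]
      exact hM.2 t ht

theorem IsKernelSemigroup.fullGenerator_fam (h : IsKernelSemigroup T) :
    fullGenerator h.fam.op = fullGenerator T := fullGenerator_congr fun _ ht => h.fam_op ht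

/-- An exponentially bounded semigroup of operators is a semigroup of kernel operators. -/
theorem KFam.IsSemi.isKernelSemigroup {U : KFam E} (hs : U.IsSemi) {C w : ℝ}
    (hU : U.ExpBd C w) : IsKernelSemigroup U.op where
  kernel t _ := (U.bp t).isKernelOperator
  add s t hs' ht f := hs s t hs' ht f
  exp_bounded := ⟨C + 1, w, by linarith [hU.nonneg], fun t _ =>
    (hU.mono_both (by linarith) le_rfl).bound t⟩
  measurable f := (U.meas f).comp
    (f := fun p : Ioi (0 : ℝ) × E => ((p.1 : ℝ), p.2)) (by fun_prop)

/-- A norm bound that is integrable near zero, for a family that evolves under a semigroup,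
gives Laplace transforms for all large parameters. -/
theorem exists_lapBd {T V : KFam E} (hT : T.ExpBd M w)
    (hVT : ∀ s t, 0 < s → 0 < t → ∀ f, V.op (t + s) f = V.op t (T.op s f)) {φ : ℝ → ℝ} {δ : ℝ}
    (hδ : 0 < δ) (hφ : IntegrableOn φ (Ioo 0 δ)) (hb : ∀ t, 0 < t → OpNormLE (V.op t) (φ t)) :
    ∃ ψ : ℝ → ℝ, (∀ t ≤ 0, ψ t = 0) ∧ ∀ l, w < l → V.LapBd ψ l := by
  have habs : ∀ t, 0 < t → OpNormLE (V.op t) |φ t| := fun t ht => (hb t ht).mono (le_abs_self _)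
  -- For $t\ge\delta$ factor $V(t)=V(\delta/2)T(t-\delta/2)$: a single value of φ then controls all
  -- later times.
  let A : ℝ := |φ (δ / 2)| * (M * Real.exp (-w * (δ / 2)))
  have hA : 0 ≤ A := mul_nonneg (abs_nonneg _) (mul_nonneg hT.nonneg (Real.exp_pos _).le)
  refine ⟨fun t => (Ioo 0 δ).indicator (fun t => |φ t|) t +
    (Ici δ).indicator (fun t => A * Real.exp (w * t)) t, fun t ht => ?_, fun l hl => ⟨fun t => ?_,
      fun t => ?_, ?_⟩⟩
  · simp only
    rw [indicator_of_notMem (fun h => absurd h.1 ht.not_gt),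
      indicator_of_notMem (fun h => absurd (mem_Ici.1 h) (by linarith)), add_zero]
  · exact add_nonneg (indicator_nonneg (fun _ _ => abs_nonneg _) _)
      (indicator_nonneg (fun _ _ => mul_nonneg hA (Real.exp_pos _).le) _)
  · rcases le_or_gt t 0 with ht | ht
    · rw [V.zero t ht]
      exact opNormLE_zero (add_nonneg (indicator_nonneg (fun _ _ => abs_nonneg _) _)
        (indicator_nonneg (fun _ _ => mul_nonneg hA (Real.exp_pos _).le) _))
    · rcases lt_or_ge t δ with h | h
      · rw [indicator_of_mem (show t ∈ Ioo 0 δ from ⟨ht, h⟩),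
          indicator_of_notMem (notMem_Ici.2 h), add_zero]
        exact habs t ht
      · rw [indicator_of_notMem (fun h' => absurd h'.2 h.not_gt), indicator_of_mem (mem_Ici.2 h),
          zero_add]
        intro f c hc x
        have hd : 0 < t - δ / 2 := by linarith
        have h1 := habs (δ / 2) (by linarith) _ _ (hT.bound (t - δ / 2) f c hc) x
        rw [← hVT _ _ hd (by linarith : 0 < δ / 2), add_sub_cancel] at h1
        refine h1.trans (le_of_eq ?_)
        simp only [A]
        rw [show w * (t - δ / 2) = -w * (δ / 2) + w * t by ring, Real.exp_add]
        ring
  · simp_rw [mul_add]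
    refine Integrable.add ?_ ?_
    · have h1 : IntegrableOn (fun t => Real.exp (-l * t) * |φ t|) (Ioo 0 δ) := by
        exact IntegrableOn.continuousOn_mul_of_subset (K := Icc 0 δ)
          (g := fun t => Real.exp (-l * t)) (by fun_prop) hφ.abs isCompact_Icc measurableSet_Ioo
          Ioo_subset_Icc_self
      refine ((integrable_indicator_iff measurableSet_Ioo).2 h1).congr (ae_of_all _ fun t => ?_)
      by_cases h : t ∈ Ioo 0 δ <;> simp [h]
    · have h1 : IntegrableOn (fun t => Real.exp (-(l - w) * t)) (Ici δ) :=
        (integrableOn_Ici_iff_integrableOn_Ioi).2 (exp_neg_integrableOn_Ioi δ (by linarith))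
      refine ((integrable_indicator_iff measurableSet_Ici).2 (h1.const_mul A)).congr
        (ae_of_all _ fun t => ?_)
      by_cases h : t ∈ Ici δ
      · simp only [indicator_of_mem h]
        rw [mul_left_comm, ← Real.exp_add]
        ring_nf
      · simp [indicator_of_notMem h]

/-- Dominated convergence as $l\to\infty$; `h0` is needed because $e^{-lt}$ grows with $l$ for
negative $t$. -/
theorem eventually_integral_exp_lt {V : KFam E} {ψ : ℝ → ℝ} (h0 : ∀ t ≤ 0, ψ t = 0)
    (hV : ∀ l, w < l → V.LapBd ψ l) : ∀ᶠ l in atTop, ∫ t, Real.exp (-l * t) * ψ t < 1 := by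
  have hw : w < w + 1 := by linarith
  have h := tendsto_integral_filter_of_dominated_convergence (μ := volume) (l := (atTop : Filter ℝ))
    (F := fun l t => Real.exp (-l * t) * ψ t) (f := fun _ => (0 : ℝ))
    (fun t => Real.exp (-(w + 1) * t) * ψ t)
    ((eventually_gt_atTop w).mono fun l hl => (hV l hl).int.aestronglyMeasurable)
    ((eventually_ge_atTop (w + 1)).mono fun l hl => ae_of_all _ fun t => ?_) (hV _ hw).int
    (ae_of_all _ fun t => ?_)
  · rw [integral_zero] at h
    exact h.eventually_lt_const one_pos
  · rcases le_or_gt t 0 with ht | ht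
    · simp [h0 t ht]
    · rw [norm_mul, Real.norm_of_nonneg (Real.exp_pos _).le, Real.norm_of_nonneg ((hV _ hw).nonneg t)]
      refine mul_le_mul_of_nonneg_right (Real.exp_le_exp.2 ?_) ((hV _ hw).nonneg t)
      nlinarith
  · rcases le_or_gt t 0 with ht | ht
    · simp [h0 t ht]
    · have h1 : Tendsto (fun l : ℝ => Real.exp (-l * t)) atTop (𝓝 0) := by
        simp_rw [neg_mul]
        exact Real.tendsto_exp_neg_atTop_nhds_zero.comp (tendsto_id.atTop_mul_const ht)
      simpa using h1.mul_const (ψ t)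

end Algebraic

section Topological

variable {E : Type*} [TopologicalSpace E] [MeasurableSpace E]
  {T : ℝ → (Bb E →ₗ[ℝ] Bb E)} {M ω : ℝ} {B : Bb E →ₗ.[ℝ] Bb E} {BT : ℝ → (Bb E →ₗ[ℝ] Bb E)}

theorem IsCbSemigroup.stochCont (h : IsCbSemigroup T) : h.toIsKernelSemigroup.fam.StochCont := by
  intro f hf x
  have h1 := h.stoch_cont f hf (Measure.dirac x).toSignedMeasure
  simp_rw [sintegral_dirac] at h1
  refine h1.congr' ?_
  filter_upwards [self_mem_nhdsWithin] with t ht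
  rw [h.toIsKernelSemigroup.fam_op ht]

/-- Equal generators of strong Feller `C_b`-semigroups imply equal semigroups. -/
theorem IsCbSemigroup.eq_of_fullGenerator_eq {S : ℝ → (Bb E →ₗ[ℝ] Bb E)} (hT : IsCbSemigroup T)
    (hS : IsCbSemigroup S) (hFT : ∀ t, 0 < t → IsStrongFeller (T t))
    (hFS : ∀ t, 0 < t → IsStrongFeller (S t)) (h : fullGenerator T = fullGenerator S) {t : ℝ}
    (ht : 0 < t) : T t = S t := by
  obtain ⟨M, w, hM⟩ := hT.exp_bounded
  obtain ⟨M', w', hM'⟩ := hS.exp_bounded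
  rw [← hT.toIsKernelSemigroup.fam_op ht, ← hS.toIsKernelSemigroup.fam_op ht]
  refine KFam.op_eq_of_fullGenerator_eq hT.isSemi hS.isSemi (hT.expBd hM) (hS.expBd hM')
    hT.stochCont hS.stochCont (fun t ht => ?_) (fun t ht => ?_) ?_ ht
  · rw [hT.toIsKernelSemigroup.fam_op ht]; exact hFT t ht
  · rw [hS.toIsKernelSemigroup.fam_op ht]; exact hFS t ht
  · rw [IsKernelSemigroup.fullGenerator_fam, IsKernelSemigroup.fullGenerator_fam, h]

namespace PerturbationHyp

theorem ker (hyp : PerturbationHyp T M ω B BT) : IsKernelSemigroup T := hyp.cb.toIsKernelSemigroup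

theorem expBd (hyp : PerturbationHyp T M ω B BT) : hyp.ker.fam.ExpBd M ω := hyp.ker.expBd hyp.type

/-- The family `B T(t)`, extended by zero. -/
def famBT (hyp : PerturbationHyp T M ω B BT) : KFam E :=
  KFam.ofOps BT hyp.BT_kernel hyp.BT_measurable

theorem famBT_op (hyp : PerturbationHyp T M ω B BT) {t : ℝ} (ht : 0 < t) :
    hyp.famBT.op t = BT t := KFam.ofOps_op _ _ ht

theorem domain' (hyp : PerturbationHyp T M ω B BT) (u f : Bb E)
    (h : (u, f) ∈ fullGenerator hyp.ker.fam.op) : u ∈ B.domain :=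
  hyp.domain u f (by rwa [hyp.ker.fullGenerator_fam] at h)

/-- The value `v` is a variable with an equation because the membership proof depends on it; this
allows different expressions for the same function. -/
theorem famBT_apply (hyp : PerturbationHyp T M ω B BT) {t : ℝ} (ht : 0 < t) {u f : Bb E}
    (h : (u, f) ∈ fullGenerator hyp.ker.fam.op) {v : Bb E} (hv : hyp.ker.fam.op t u = v)
    (hv' : v ∈ B.domain) : hyp.famBT.op t u = B ⟨v, hv'⟩ := by
  subst hv
  rw [hyp.ker.fullGenerator_fam] at h
  simp only [hyp.ker.fam_op ht] at hv' ⊢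
  rw [hyp.famBT_op ht]
  exact hyp.BT_extends t ht u f h hv'

section

variable [TopologicalSpace.PseudoMetrizableSpace E] [BorelSpace E]

/-- On $D(\hat A)$ both sides are $\hat B$ applied to $T(t+s)u$, and the domain determines kernel
operators. -/
theorem famBT_add (hyp : PerturbationHyp T M ω B BT) (s t : ℝ) (hs : 0 < s) (ht : 0 < t)
    (f : Bb E) : hyp.famBT.op (t + s) f = hyp.famBT.op t (hyp.ker.fam.op s f) := by
  have h := hyp.cb.stochCont.op_ext_of_generator hyp.ker.isSemi hyp.expBd
    (W₁ := hyp.famBT.op (t + s)) (W₂ := hyp.famBT.op t ∘ₗ hyp.ker.fam.op s) (hyp.famBT.bp _)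
    ((hyp.famBT.bp _).comp (hyp.ker.fam.bp _)) fun u f hu => by
      have h1 := hyp.ker.isSemi.op_mem hyp.expBd hs hu
      have h2 := hyp.domain' _ _ (hyp.ker.isSemi.op_mem hyp.expBd ht h1)
      rw [hyp.famBT_apply (add_pos ht hs) hu (hyp.ker.isSemi s t hs ht u) h2, LinearMap.comp_apply,
        hyp.famBT_apply ht h1 rfl h2]
  exact congrArg (fun W : Bb E →ₗ[ℝ] Bb E => W f) h

theorem exists_lapBd (hyp : PerturbationHyp T M ω B BT) :
    ∃ ψ : ℝ → ℝ, (∀ t ≤ 0, ψ t = 0) ∧ ∀ l, ω < l → hyp.famBT.LapBd ψ l := by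
  obtain ⟨φ, ⟨δ, hδ, hφ⟩, hb⟩ := hyp.BT_bound
  exact FellerPert.exists_lapBd hyp.expBd hyp.famBT_add hδ hφ fun t ht => by
    rw [hyp.famBT_op ht]; exact hb t ht

/-- If `B R(l)` is a kernel operator, then it is the Laplace transform of `B T(t)`. -/
theorem eq_lap (hyp : PerturbationHyp T M ω B BT) {l : ℝ} (hl : ω < l) {ψ : ℝ → ℝ}
    (hV : hyp.famBT.LapBd ψ l) {K : Bb E →ₗ[ℝ] Bb E} (hK : IsBpOp K)
    (hB : ∀ u f, (u, f) ∈ fullGenerator hyp.ker.fam.op → ∀ hu : u ∈ B.domain,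
      B ⟨u, hu⟩ = K (l • u - f)) : K = hyp.famBT.lap hV := by
  -- It suffices to compare after $T(r)$: there $KT(r)f=\hat BT(r)R(l)f$, and the kernel operator
  -- $\hat BT(r)$ may be taken inside the Laplace integral.
  refine hyp.cb.stochCont.op_ext hyp.expBd hK (KFam.isBpOp_lap hV) fun r hr f => ?_
  have hs := hyp.ker.isSemi
  have hmem := hs.res_mem hyp.expBd hl f
  have hmem' := hs.op_mem hyp.expBd hr hmem
  have hdom := hyp.domain' _ _ hmem'
  have h1 := hB _ _ hmem' hdom
  rw [← map_smul (hyp.ker.fam.op r), ← map_sub (hyp.ker.fam.op r), sub_sub_cancel] at h1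
  rw [← h1, ← hyp.famBT_apply hr hmem rfl hdom]
  refine Bb.ext fun x => ?_
  rw [KFam.res, KFam.op_lap_apply (hyp.famBT.bp r), KFam.lap_apply]
  refine integral_congr_ae (ae_of_all _ fun s => ?_)
  simp only
  rcases le_or_gt s 0 with h | h
  · simp [hyp.ker.fam.zero s h, hyp.famBT.zero s h]
  · rw [← hyp.famBT_add s r h hr, ← hyp.famBT_add r s hr h, add_comm]

/-- The perturbation on the domain of the full generator, in terms of the Laplace transform. -/
theorem apply_eq_lap (hyp : PerturbationHyp T M ω B BT) {l : ℝ} (hl : ω < l) {ψ : ℝ → ℝ}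
    (hV : hyp.famBT.LapBd ψ l) (u f : Bb E) (h : (u, f) ∈ fullGenerator hyp.ker.fam.op)
    (hu : u ∈ B.domain) : B ⟨u, hu⟩ = hyp.famBT.lap hV (l • u - f) := by
  obtain ⟨l₀, hl₀, K, hK, hKB⟩ := hyp.BR_kernel
  have hs := hyp.ker.isSemi
  have h0 : ∀ u f, (u, f) ∈ fullGenerator hyp.ker.fam.op → ∀ hu : u ∈ B.domain,
      B ⟨u, hu⟩ = K (l₀ • u - f) := fun u f h hu => by
    refine (hKB _ _ hu ?_).symm
    have h1 := congrArg (fun g : Bb E => (g : E → ℝ))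
      ((hs.mem_fullGenerator_iff hyp.expBd hl₀ u f).1 h)
    simp only [KFam.res_eq_laplaceFun] at h1
    rw [h1]
    funext x
    refine setIntegral_congr_fun measurableSet_Ioi fun t ht => ?_
    rw [hyp.ker.fam_op ht]
  let R := hyp.ker.fam.res hyp.expBd hl
  -- The resolvent equation moves the kernel property from `l₀` to every `l > ω`, as $u=R(l)(lu-f)$.
  have h1 : ∀ u f, (u, f) ∈ fullGenerator hyp.ker.fam.op → ∀ hu : u ∈ B.domain,
      B ⟨u, hu⟩ = (K ∘ₗ (LinearMap.id + (l₀ - l) • R)) (l • u - f) := fun u f h hu => by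
    rw [h0 u f h hu, LinearMap.comp_apply, LinearMap.add_apply, LinearMap.smul_apply,
      ← (hs.mem_fullGenerator_iff hyp.expBd hl u f).1 h, LinearMap.id_apply, sub_smul]
    congr 1
    abel
  rw [← hyp.eq_lap hl hV (hK.isBpOp.comp (isBpOp_id.add ((KFam.isBpOp_res _ _).smul _))) h1]
  exact h1 u f h hu

/-- The perturbed semigroup, with the estimates and mapping properties that come from its
Dyson–Phillips series. -/
theorem exists_semigroup (hyp : PerturbationHyp T M ω B BT) :
    ∃ (S : ℝ → (Bb E →ₗ[ℝ] Bb E)) (η : ℝ → ℝ), IsPerturbedSemigroup T B S ∧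
      Tendsto η (𝓝[>] 0) (𝓝 0) ∧
      (∀ t, 0 < t → ∀ (f : Bb E) c, (∀ x, |f x| ≤ c) → ∀ x, |S t f x - T t f x| ≤ η t * c) ∧
      ((cocompact E).IsCountablyGenerated → (∀ t, 0 < t → ∀ f ∈ Binf E, T t f ∈ Binf E) →
        (∀ t, 0 < t → ∀ f ∈ Binf E, BT t f ∈ Binf E) → ∀ t, ∀ f ∈ Binf E, S t f ∈ Binf E) := by
  obtain ⟨ψ, hψ0, hψ⟩ := hyp.exists_lapBd
  have hev := eventually_integral_exp_lt hψ0 hψ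
  -- The series is built at `l`, so `S` is only known to have exponent `l`; its resolvent is taken
  -- at `l + 1`, where the transform must also be below 1.
  obtain ⟨l, ⟨hl, hq⟩, hq'⟩ := (((eventually_gt_atTop ω).and hev).and
    ((tendsto_atTop_add_const_right atTop (1 : ℝ) tendsto_id).eventually hev)).exists
  simp only [id_eq] at hq'
  have hT := hyp.expBd.mono hl.le
  have hV := hψ l hl
  set S := dysonSum hT hV hq with hSdef
  have heq := dysonSum_eq hT hV hq
  have hS := expBd_dysonSum hT hV hq
  have hs : S.IsSemi := hyp.ker.isSemi.of_volterra hV hq hyp.famBT_add hS heq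
  obtain ⟨η, hη, hST⟩ := exists_volterra_modulus hV hS heq
  have hST' : ∀ t, 0 < t → ∀ (f : Bb E) c, (∀ x, |f x| ≤ c) → ∀ x,
      |S.op t f x - T t f x| ≤ η t * c := fun t ht f c hc x => by
    rw [← hyp.ker.fam_op ht]; exact hST t ht f c hc x
  have hF : ∀ t f, S.op t f ∈ Cb E := dysonSum_mem_Cb hT hV hq fun t ht => by
    rw [hyp.ker.fam_op ht]; exact hyp.strongFeller t ht
  refine ⟨S.op, η, ⟨⟨hs.isKernelSemigroup hS, fun t _ f _ => hF t f, fun f hf μ => ?_⟩,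
    fun t _ f => hF t f, ?_⟩, hη, hST', fun hcg hTB hVB t f hf => ?_⟩
  · obtain ⟨c, _, hc⟩ := Bb.exists_bound f
    -- Weak continuity of `S` follows from that of `T`, since their difference tends to zero in
    -- norm.
    have h1 : Tendsto (fun t => sintegral (S.op t f) μ - sintegral (T t f) μ) (𝓝[>] 0) (𝓝 0) := by
      have h2 : Tendsto (fun t => η t * c * μ.totalVariation.real univ) (𝓝[>] 0) (𝓝 0) := by
        simpa using (hη.mul_const c).mul_const (μ.totalVariation.real univ)
      refine squeeze_zero_norm' ?_ h2
      filter_upwards [self_mem_nhdsWithin] with t ht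
      have h3 : sintegral (S.op t f) μ - sintegral (T t f) μ =
          sintegral (S.op t f + (-1 : ℝ) • T t f : Bb E) μ := by
        rw [sintegral_add, sintegral_smul]; ring
      rw [h3]
      refine abs_sintegral_le _ (fun x => ?_) μ
      have := hST' t ht f c hc x
      rwa [Bb.add_apply, Bb.smul_apply, neg_one_mul, ← sub_eq_add_neg]
    simpa using h1.add (hyp.cb.stoch_cont f hf μ)
  · rw [← hyp.ker.fullGenerator_fam]
    exact fullGenerator_volterra hyp.ker.isSemi hs hyp.expBd hS (hψ (l + 1) (by linarith))
      (by linarith) (by linarith) heq hq' hyp.domain'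
      (hyp.apply_eq_lap (by linarith) (hψ (l + 1) (by linarith)))
  · refine dysonSum_mem_Binf hT hV hq (fun t f hf => ?_) (fun t f hf => ?_) t f hf
    · rcases le_or_gt t 0 with h | h
      · rw [KFam.zero _ t h]
        exact fun ε hε => ⟨∅, isCompact_empty, fun x _ => by simpa using hε.le⟩
      · rw [hyp.ker.fam_op h]; exact hTB t h f hf
    · rcases le_or_gt t 0 with h | h
      · rw [KFam.zero _ t h]
        exact fun ε hε => ⟨∅, isCompact_empty, fun x _ => by simpa using hε.le⟩
      · rw [hyp.famBT_op h]; exact hVB t h f hf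

/-- bp-cores of the generator are mapped to bp-cores of the perturbed generator. -/
theorem isBpCore_addOp (hyp : PerturbationHyp T M ω B BT) {D : Set (Bb E × Bb E)}
    (hD : IsBpCore D (fullGenerator T)) : IsBpCore (addOp D B) (addOp (fullGenerator T) B) := by
  have hsub : addOp D B ⊆ addOp (fullGenerator T) B := by
    rintro p ⟨u, f, h, hu, rfl⟩
    exact ⟨u, f, hD.1 h, hu, rfl⟩
  refine ⟨hsub, Subset.antisymm ?_ ?_⟩
  · obtain ⟨S, η, hS, -⟩ := hyp.exists_semigroup
    obtain ⟨M', w', hM'⟩ := hS.cb.exp_bounded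
    have hk := hS.cb.toIsKernelSemigroup
    have hcl := hk.isSemi.isBpClosed (hk.expBd hM')
    rw [hk.fullGenerator_fam, hS.generator] at hcl
    exact sInter_subset_of_mem ⟨hcl, hsub⟩
  · obtain ⟨ψ, -, hψ⟩ := hyp.exists_lapBd
    -- Any value above `ω` serves: only bp-continuity of the Laplace transform is used, not its
    -- smallness.
    have hl : ω < ω + 1 := by linarith
    have hV := hψ _ hl
    have hB := hyp.apply_eq_lap hl hV
    have hclA := hyp.ker.isSemi.isBpClosed hyp.expBd
    rw [hyp.ker.fullGenerator_fam] at hB hclA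
    refine subset_sInter ?_
    rintro N ⟨hN, hDN⟩
    -- The preimage of `N`, with the Laplace transform in place of `B`; restricting to the generator
    -- is what makes the two agree.
    let N' : Set (Bb E × Bb E) := {p | p ∈ fullGenerator T ∧
      (p.1, p.2 + hyp.famBT.lap hV ((ω + 1) • p.1 - p.2)) ∈ N}
    have hN' : IsBpClosed N' := by
      intro p q hp h1 h2
      refine ⟨hclA p q (fun n => (hp n).1) h1 h2, ?_⟩
      exact hN (fun n => ((p n).1, (p n).2 + hyp.famBT.lap hV ((ω + 1) • (p n).1 - (p n).2))) _
        (fun n => (hp n).2) h1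
        (h2.add ((KFam.isBpOp_lap hV).bpTendsto ((h1.const_smul (ω + 1)).sub h2)))
    have hDN' : D ⊆ N' := by
      rintro ⟨u, f⟩ h
      refine ⟨hD.1 h, ?_⟩
      have hu := hyp.domain u f (hD.1 h)
      simp only
      rw [← hB u f (hD.1 h) hu]
      exact hDN ⟨u, f, h, hu, rfl⟩
    rintro p ⟨u, f, h, hu, rfl⟩
    rw [← hD.2] at h
    have h' := h N' ⟨hN', hDN'⟩
    rw [hB u f h'.1 hu]
    exact h'.2

end

end PerturbationHyp

end Topological

end

end

end FellerPert

theorem theorem4p3 {E : Type*} [TopologicalSpace E] [PolishSpace E] [LocallyCompactSpace E]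
    [MeasurableSpace E] [BorelSpace E]
    (T : ℝ → (Bb E →ₗ[ℝ] Bb E)) (M ω : ℝ) (B : Bb E →ₗ.[ℝ] Bb E)
    (BT : ℝ → (Bb E →ₗ[ℝ] Bb E)) (hyp : PerturbationHyp T M ω B BT)
    (hpos : ∀ t, 0 < t → IsPositiveOp (T t)) (hinf : IsCinfSemigroup T) :
    -- (a)
    (∀ D : Set (Bb E × Bb E), IsBpCore D (fullGenerator T) →
      IsBpCore (addOp D B) (addOp (fullGenerator T) B)) ∧
    -- the perturbed semigroup exists
    (∃ S : ℝ → (Bb E →ₗ[ℝ] Bb E), IsPerturbedSemigroup T B S) ∧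
    -- (b)
    ((∀ t, 0 < t → ∀ f ∈ Binf E, BT t f ∈ Binf E) →
      ∀ S : ℝ → (Bb E →ₗ[ℝ] Bb E), IsPerturbedSemigroup T B S → IsCinfSemigroup S) := by
  obtain ⟨S₀, η, hS₀, hη, hbd, hBinf⟩ := hyp.exists_semigroup
  refine ⟨fun D hD => hyp.isBpCore_addOp hD, ⟨S₀, hS₀⟩, fun hBT S hS => ?_⟩
  -- The norm estimate and the invariance are known only for the series solution, so an arbitrary
  -- `S` is first identified with it.
  have heq : ∀ t, 0 < t → S t = S₀ t := fun t ht =>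
    hS.cb.eq_of_fullGenerator_eq hS₀.cb hS.strongFeller hS₀.strongFeller
      (hS.generator.trans hS₀.generator.symm) ht
  have hTB : ∀ t, 0 < t → ∀ f ∈ Binf E, T t f ∈ Binf E := fun t ht f hf =>
    (hpos t ht).mem_Binf (hyp.type.2 t ht) (hinf.map_Cinf t ht) hf
  have hSB := hBinf (isCountablyGenerated_cocompact E) hTB hBT
  refine ⟨hS.cb.toIsKernelSemigroup, fun t ht f hf => ⟨hS.strongFeller t ht f, ?_⟩,
    fun f hf => ?_⟩
  · rw [heq t ht]
    exact hSB t f hf.2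
  · obtain ⟨c, _, hc⟩ := Bb.exists_bound f
    rw [Metric.tendstoUniformly_iff]
    intro ε hε
    have h1 := (Metric.tendstoUniformly_iff.1 (hinf.strong_cont f hf)) (ε / 2) (by positivity)
    have h2 : Tendsto (fun t => η t * c) (𝓝[>] 0) (𝓝 0) := by simpa using hη.mul_const c
    filter_upwards [h1, h2.eventually_lt_const (half_pos hε), self_mem_nhdsWithin]
      with t ht1 ht2 ht x
    rw [heq t ht]
    have h3 := ht1 x
    have h4 := hbd t ht f c hc x
    rw [dist_comm, Real.dist_eq] at h3
    rw [dist_comm, Real.dist_eq]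
    calc |S₀ t f x - f x| = |(S₀ t f x - T t f x) + (T t f x - f x)| := by ring_nf
      _ ≤ _ := abs_add_le _ _
      _ < ε := by linarith
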